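/- Let $T$ be a recursively axiomatized first-order theory (classical logic with equality) in a countable language containing the symbols $0,S,+,\cdot,\le$ of arithmetic; that is, $T$ is given by a set of axioms together with a program $e$ which decides the set of their Gödel numbers. Let $\mathrm{EA}=I\Delta_0+\mathrm{Exp}$ be elementary arithmetic (Robinson arithmetic, induction for $\Delta_0$-formulas, totality of $x\mapsto 2^x$). Let $\mathrm{Proof}_T(p,x)$ be the arithmetical formula, built from $e$, which formalizes "$p$ codes a $T$-derivation of the formula with Gödel number $x$"; here a coded derivation is a finite sequence of lines, each obtained from earlier lines by a rule of a fixed Hilbert calculus, and it also contains the verifications of the syntactic side conditions and of the computations of $e$ showing that the nonlogical axioms used are axioms of $T$. For $n\in\mathbb N$ let $\bar n$ be the $n$-th numeral, let $\ulcorner 0=1\urcorner$ be (the numeral of) the Gödel number of the sentence $0=1$, and let $\mathrm{Con}_n(T):\equiv\neg\,\mathrm{Proof}_T(\bar n,\ulcorner 0=1\urcorner)$. Then: (1) it is decidable, by an algorithm with input $n\in\mathbb N$, whether $n$ codes a $T$-derivation of $0=1$, and $\mathrm{EA}$ verifies the outcome for each standard $n$: if $n$ codes a $T$-derivation of $0=1$,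 then $\mathrm{EA}\vdash\mathrm{Proof}_T(\bar n,\ulcorner 0=1\urcorner)$, and otherwise $\mathrm{EA}\vdash\neg\,\mathrm{Proof}_T(\bar n,\ulcorner 0=1\urcorner)$; (2) in particular, if $T$ is consistent and extends $\mathrm{EA}$ (every axiom of $\mathrm{EA}$ is a theorem of $T$), then $T\vdash\mathrm{Con}_n(T)$ for every $n\in\mathbb N$. -/

import Mathlib

open FirstOrder

namespace ConsistencySchema

/-! ### The language -/

/-- The language in which theories are formulated: countably many function symbols and countably
many relation symbols of every arity. The symbols `0`, `S`, `+`, `·`, `≤` of arithmetic are five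
of them; a theory may use as many of the remaining ones as it likes. -/
abbrev L : FirstOrder.Language.{0, 0} := ⟨fun _ => ℕ, fun _ => ℕ⟩

section Symbols

variable {α : Type}

/-- The constant `0`. -/
def zero : L.Term α := FirstOrder.Language.Term.func (l := 0) (0 : ℕ) ![]

/-- The successor `S t`. -/
def succ (t : L.Term α) : L.Term α := FirstOrder.Language.Term.func (l := 1) (0 : ℕ) ![t]

/-- The sum `t + s`. -/
def add (t s : L.Term α) : L.Term α := FirstOrder.Language.Term.func (l := 2) (0 : ℕ) ![t, s]

/-- The product `t · s`. -/
def mul (t s : L.Term α) : L.Term α := FirstOrder.Language.Term.func (l := 2) (1 : ℕ) ![t, s]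

/-- The standard numeral `S (S (⋯ 0))`. -/
def num : ℕ → L.Term α
  | 0 => zero
  | k + 1 => succ (num k)

/-- The atomic formula `t ≤ s`. -/
def le {n : ℕ} (t s : L.Term (α ⊕ Fin n)) : L.BoundedFormula α n :=
  FirstOrder.Language.BoundedFormula.rel (l := 2) (0 : ℕ) ![t, s]

/-- A term seen in the scope of one more quantifier. -/
def up {n : ℕ} (t : L.Term (α ⊕ Fin n)) : L.Term (α ⊕ Fin (n + 1)) :=
  t.relabel (Sum.map id Fin.castSucc)

/-- The `k`-th bound variable. -/
def bd {n : ℕ} (k : Fin n) : L.Term (α ⊕ Fin n) := FirstOrder.Language.Term.var (Sum.inr k)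

/-- The variable bound by the innermost quantifier. -/
def last {n : ℕ} : L.Term (α ⊕ Fin (n + 1)) := bd (Fin.last n)

/-- The bounded quantifier `∀ x ≤ t, φ`; the term `t` does not contain `x`. -/
def ball {n : ℕ} (t : L.Term (α ⊕ Fin n)) (φ : L.BoundedFormula α (n + 1)) :
    L.BoundedFormula α n :=
  ∀' (le last (up t) ⟹ φ)

/-- The bounded quantifier `∃ x ≤ t, φ`, as an abbreviation of `¬ ∀ x ≤ t, ¬ φ`. -/
def bex {n : ℕ} (t : L.Term (α ⊕ Fin n)) (φ : L.BoundedFormula α (n + 1)) :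
    L.BoundedFormula α n :=
  ∼(ball t ∼φ)

/-- Simultaneous substitution of terms for the variables of index `< m` in a formula all of whose
bound variables of index `< m` are not yet quantified. -/
def bsub : ∀ {m : ℕ}, L.BoundedFormula α m → ∀ {n : ℕ}, (Fin m → L.Term (α ⊕ Fin n)) →
    L.BoundedFormula α n
  | _, .falsum, _, _ => .falsum
  | _, .equal t s, _, f =>
      .equal (t.subst (Sum.elim (fun a => .var (Sum.inl a)) f))
        (s.subst (Sum.elim (fun a => .var (Sum.inl a)) f))
  | _, .rel R ts, _, f =>
      .rel R fun i => (ts i).subst (Sum.elim (fun a => .var (Sum.inl a)) f)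
  | _, .imp φ ψ, _, f => .imp (bsub φ f) (bsub ψ f)
  | _, .all φ, _, f => .all (bsub φ (Fin.snoc (fun i => up (f i)) last))

/-- The instance `φ[t]` of a formula `φ` with one variable still to be quantified. -/
def inst (φ : L.BoundedFormula α 1) (t : L.Term (α ⊕ Fin 0)) : L.BoundedFormula α 0 :=
  bsub φ fun _ => t

end Symbols

/-! ### Derivability -/

/-- The formula with free variables `x₀, x₁, …` (none of which occurs) given by a sentence. -/
def embed (σ : L.Sentence) : L.Formula ℕ :=
  FirstOrder.Language.BoundedFormula.subst σ (fun a : Empty => a.elim)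

/-- The free variable `xᵢ`. -/
def fvar (i : ℕ) : L.Term (ℕ ⊕ Fin 0) := .var (Sum.inl i)

/-- Derivability from the theory `T` in a Hilbert calculus for classical first-order predicate
logic with equality; the primitive connectives are `⊥`, `→`, `∀`. -/
inductive Derivable (T : L.Theory) : L.BoundedFormula ℕ 0 → Prop
  | ax (σ : L.Sentence) (h : σ ∈ T) : Derivable T (embed σ)
  | weak (φ ψ) : Derivable T (φ ⟹ (ψ ⟹ φ))
  | frege (φ ψ χ) : Derivable T ((φ ⟹ (ψ ⟹ χ)) ⟹ ((φ ⟹ ψ) ⟹ (φ ⟹ χ)))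
  | dne (φ) : Derivable T (((φ ⟹ ⊥) ⟹ ⊥) ⟹ φ)
  | spec (φ : L.BoundedFormula ℕ 1) (t) : Derivable T ((∀' φ) ⟹ inst φ t)
  | refl (t : L.Term (ℕ ⊕ Fin 0)) : Derivable T (t =' t)
  | leib (t s : L.Term (ℕ ⊕ Fin 0)) (φ : L.BoundedFormula ℕ 1) :
      Derivable T ((t =' s) ⟹ (inst φ t ⟹ inst φ s))
  | mp (φ ψ) : Derivable T (φ ⟹ ψ) → Derivable T φ → Derivable T ψ
  | gen (χ) (φ : L.BoundedFormula ℕ 1) (i : ℕ) :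
      i ∉ χ.freeVarFinset → i ∉ φ.freeVarFinset →
      Derivable T (χ ⟹ inst φ (fvar i)) → Derivable T (χ ⟹ ∀' φ)

/-- `T ⊢ σ`. -/
def Proves (T : L.Theory) (σ : L.Sentence) : Prop := Derivable T (embed σ)

/-- `T` is (syntactically) consistent. -/
def Consistent (T : L.Theory) : Prop := ¬ Proves T ⊥

/-- `T` extends `U`: every axiom of `U` is a theorem of `T`. -/
def Extends (T U : L.Theory) : Prop := ∀ σ ∈ U, Proves T σ

/-! ### Arithmetized relations -/

section Arithmetic

variable {n : ℕ}

/-- `y` is the Cantor-style pair `Nat.pair u v`. -/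
def pairF (u v y : L.Term (Empty ⊕ Fin n)) : L.BoundedFormula Empty n :=
  (le (succ u) v ⊓ (y =' add (mul v v) u)) ⊔ (le v u ⊓ (y =' add (add (mul u u) u) v))

/-- `y` is the value `Nat.beta s j` of Gödel's β-function: for `s = Nat.pair a b`, the number `y`
is the remainder of `a` modulo `(j + 1) * b + 1`. -/
def betaF (s j y : L.Term (Empty ⊕ Fin n)) : L.BoundedFormula Empty n :=
  bex s (bex (up s)
    (let a : L.Term (Empty ⊕ Fin (n + 2)) := bd (Fin.castSucc (Fin.last n))
     let b : L.Term (Empty ⊕ Fin (n + 2)) := last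
     let m : L.Term (Empty ⊕ Fin (n + 2)) := succ (mul (succ (up (up j))) b)
     pairF a b (up (up s)) ⊓ le (succ (up (up y))) m ⊓
       bex a (up a =' add (mul last (up m)) (up (up (up y))))))

end Arithmetic

/-! ### Elementary arithmetic -/

/-- The terms of the language of arithmetic. -/
inductive IsArith {α : Type} : L.Term α → Prop
  | var (a : α) : IsArith (.var a)
  | zero : IsArith zero
  | succ (t) : IsArith t → IsArith (succ t)
  | add (t s) : IsArith t → IsArith s → IsArith (add t s)
  | mul (t s) : IsArith t → IsArith s → IsArith (mul t s)

/-- The `Δ₀`-formulas of the language of arithmetic. -/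
inductive IsDelta0 : ∀ {n : ℕ}, L.BoundedFormula Empty n → Prop
  | falsum {n : ℕ} : IsDelta0 (⊥ : L.BoundedFormula Empty n)
  | eq {n : ℕ} (t s : L.Term (Empty ⊕ Fin n)) : IsArith t → IsArith s → IsDelta0 (t =' s)
  | le {n : ℕ} (t s : L.Term (Empty ⊕ Fin n)) : IsArith t → IsArith s → IsDelta0 (le t s)
  | imp {n : ℕ} (φ ψ : L.BoundedFormula Empty n) : IsDelta0 φ → IsDelta0 ψ → IsDelta0 (φ ⟹ ψ)
  | ball {n : ℕ} (t : L.Term (Empty ⊕ Fin n)) (φ : L.BoundedFormula Empty (n + 1)) :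
      IsArith t → IsDelta0 φ → IsDelta0 (ball t φ)

/-- The universal closure of `φ(0) → ∀ x (φ(x) → φ(S x)) → ∀ x φ(x)`. -/
def induction {n : ℕ} (φ : L.BoundedFormula Empty (n + 1)) : L.Sentence :=
  (bsub φ (Fin.snoc (fun i => bd i) zero) ⟹
    ((∀' (φ ⟹ bsub φ (Fin.snoc (fun i => bd i.castSucc) (succ last)))) ⟹ ∀' φ)).alls

/-- The axioms of elementary arithmetic `IΔ₀ + Exp`. -/
inductive AxiomEA : L.Sentence → Prop
  -- Robinson arithmetic
  | succ_ne_zero : AxiomEA (∀' ∼(succ (bd 0) =' zero))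
  | succ_inj : AxiomEA (∀' ∀' ((succ (bd 0) =' succ (bd 1)) ⟹ (bd 0 =' bd 1)))
  | zero_or_succ : AxiomEA (∀' (∼(bd 0 =' zero) ⟹ ∃' (bd 0 =' succ (bd 1))))
  | add_zero : AxiomEA (∀' (add (bd 0) zero =' bd 0))
  | add_succ : AxiomEA (∀' ∀' (add (bd 0) (succ (bd 1)) =' succ (add (bd 0) (bd 1))))
  | mul_zero : AxiomEA (∀' (mul (bd 0) zero =' zero))
  | mul_succ : AxiomEA (∀' ∀' (mul (bd 0) (succ (bd 1)) =' add (mul (bd 0) (bd 1)) (bd 0)))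
  | le_def : AxiomEA (∀' ∀' (le (bd 0) (bd 1) ⇔ ∃' (add (bd 2) (bd 0) =' bd 1)))
  -- induction for bounded formulas
  | ind {n : ℕ} (φ : L.BoundedFormula Empty (n + 1)) (h : IsDelta0 φ) : AxiomEA (induction φ)
  -- for all `x` there is `y = 2 ^ x`: there are `y` and a code `s` of a sequence whose entry `0`
  -- is `1`, whose entry `j + 1` is twice its entry `j` for all `j < x`, and whose entry `x` is `y`
  | exp : AxiomEA (∀' ∃' ∃' (betaF (bd 2) zero (num 1) ⊓ betaF (bd 2) (bd 0) (bd 1) ⊓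
      ∀' (le (succ (bd 3)) (bd 0) ⟹
        ∃' (betaF (bd 2) (bd 3) (bd 4) ⊓ betaF (bd 2) (succ (bd 3)) (add (bd 4) (bd 4))))))

/-- Elementary arithmetic. -/
def EA : L.Theory := {σ | AxiomEA σ}

/-! ### Gödel numbers

Expressions are trees whose leaves are free variables, bound variables and numbers. -/

/-- Code of the free variable `xᵢ`. -/
def gFree (i : ℕ) : ℕ := Nat.pair 0 i
/-- Code of the bound variable of index `i`. -/
def gBound (i : ℕ) : ℕ := Nat.pair 1 i
/-- Code of the leaf labelled `k`. -/
def gAtom (k : ℕ) : ℕ := Nat.pair 2 k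
/-- Code of the tree with immediate subtrees coded by `a` and `b`. -/
def gNode (a b : ℕ) : ℕ := Nat.pair 3 (Nat.pair a b)

/-- Code of a list of expressions. -/
def gList : List ℕ → ℕ
  | [] => gAtom 0
  | a :: l => gNode a (gList l)

/-- Code of a term. -/
def gTerm {n : ℕ} : L.Term (ℕ ⊕ Fin n) → ℕ
  | .var (Sum.inl i) => gFree i
  | .var (Sum.inr i) => gBound i
  | .func (l := l) f ts =>
      gNode (gNode (gAtom l) (gAtom (f : ℕ))) (gList (List.ofFn fun i => gTerm (ts i)))

/-- Code of a formula. -/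
def gForm : ∀ {n : ℕ}, L.BoundedFormula ℕ n → ℕ
  | _, .falsum => gNode (gAtom 0) (gAtom 0)
  | _, .equal t s => gNode (gAtom 1) (gNode (gTerm t) (gTerm s))
  | _, .rel (l := l) R ts =>
      gNode (gAtom 2)
        (gNode (gNode (gAtom l) (gAtom (R : ℕ))) (gList (List.ofFn fun i => gTerm (ts i))))
  | _, .imp φ ψ => gNode (gAtom 3) (gNode (gForm φ) (gForm ψ))
  | _, .all φ => gNode (gAtom 4) (gForm φ)

/-- The Gödel number of a sentence. -/
def gSent (σ : L.Sentence) : ℕ := gForm (embed σ)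

/-- Code of a program for a partial recursive function. -/
def gProg : Nat.Partrec.Code → ℕ
  | .zero => Nat.pair 0 0
  | .succ => Nat.pair 1 0
  | .left => Nat.pair 2 0
  | .right => Nat.pair 3 0
  | .pair a b => Nat.pair 4 (Nat.pair (gProg a) (gProg b))
  | .comp a b => Nat.pair 5 (Nat.pair (gProg a) (gProg b))
  | .prec a b => Nat.pair 6 (Nat.pair (gProg a) (gProg b))
  | .rfind' a => Nat.pair 7 (gProg a)

/-- The program `e` decides which numbers are Gödel numbers of axioms of `T`. A theory is
recursively axiomatized when it is given with such a program. -/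
def Decides (e : Nat.Partrec.Code) (T : L.Theory) : Prop :=
  ∀ m : ℕ, ((∃ σ ∈ T, gSent σ = m) → 1 ∈ e.eval m) ∧ ((¬ ∃ σ ∈ T, gSent σ = m) → 0 ∈ e.eval m)

/-! ### The rules that the lines of a coded derivation obey -/

/-- Patterns for numbers, with six variables. -/
inductive Pat
  | var (i : Fin 6)
  | lit (k : ℕ)
  | suc (a : Pat)
  | pair (a b : Pat)

namespace Pat

/-- The number described by a pattern. -/
def eval (v : Fin 6 → ℕ) : Pat → ℕ
  | var i => v i
  | lit k => k
  | suc a => a.eval v + 1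
  | pair a b => Nat.pair (a.eval v) (b.eval v)

def free (i : Pat) : Pat := pair (lit 0) i
def bound (i : Pat) : Pat := pair (lit 1) i
def atom (k : Pat) : Pat := pair (lit 2) k
def node (a b : Pat) : Pat := pair (lit 3) (pair a b)

def func (l f ts : Pat) : Pat := node (node (atom l) (atom f)) ts
def falsum : Pat := node (atom (lit 0)) (atom (lit 0))
def equal (t s : Pat) : Pat := node (atom (lit 1)) (node t s)
def rel (l R ts : Pat) : Pat := node (atom (lit 2)) (node (node (atom l) (atom R)) ts)
def imp (a b : Pat) : Pat := node (atom (lit 3)) (node a b)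
def all (a : Pat) : Pat := node (atom (lit 4)) a

def pZero : Pat := pair (lit 0) (lit 0)
def pSucc : Pat := pair (lit 1) (lit 0)
def pLeft : Pat := pair (lit 2) (lit 0)
def pRight : Pat := pair (lit 3) (lit 0)
def pPair (a b : Pat) : Pat := pair (lit 4) (pair a b)
def pComp (a b : Pat) : Pat := pair (lit 5) (pair a b)
def pPrec (a b : Pat) : Pat := pair (lit 6) (pair a b)
def pFind (a : Pat) : Pat := pair (lit 7) a

/-! The lines of a coded derivation are of the following eight forms. -/

/-- `x ≠ y`. -/
def jNe (x y : Pat) : Pat := pair (lit 0) (pair x y)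
/-- `t` codes a term whose bound variables have index `< n`. -/
def jTerm (n t : Pat) : Pat := pair (lit 1) (pair n t)
/-- `ts` codes a list of `k` terms whose bound variables have index `< n`. -/
def jTerms (n k ts : Pat) : Pat := pair (lit 2) (pair n (pair k ts))
/-- `a` codes a formula whose not yet quantified bound variables have index `< n`. -/
def jForm (n a : Pat) : Pat := pair (lit 3) (pair n a)
/-- The free variable `x` does not occur in the expression coded by `a`. -/
def jFresh (x a : Pat) : Pat := pair (lit 4) (pair x a)
/-- `b` codes the result of putting the term coded by `t` for the bound variable of index `0` in
the expression coded by `a` and lowering all other indices by one. -/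
def jInst (t a b : Pat) : Pat := pair (lit 5) (pair t (pair a b))
/-- The program coded by `c` has output `y` on input `x`. -/
def jEval (c x y : Pat) : Pat := pair (lit 6) (pair c (pair x y))
/-- `a` codes a formula derivable from the theory. -/
def jDer (a : Pat) : Pat := pair (lit 7) a

end Pat

/-- A rule: from the instances of the premises infer the same instance of the conclusion. -/
structure Rule where
  prem : List Pat
  concl : Pat

section Rules

open Pat

/-- The rules for lines that verify the side conditions of logical axioms and rules (the code is
one of a term or of a formula, a variable does not occur, an expression is the result of a
substitution), following the recursive definitions of these notions. -/
def sideRules : List Rule :=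
  let a := var 0
  let b := var 1
  let c := var 2
  let d := var 3
  let f := var 4
  [ ⟨[], jNe (lit 0) (suc a)⟩,
    ⟨[], jNe (suc a) (lit 0)⟩,
    ⟨[jNe a b], jNe (suc a) (suc b)⟩,
    ⟨[], jTerm a (free b)⟩,
    ⟨[], jTerm (suc a) (bound a)⟩,
    ⟨[jTerm a (bound b)], jTerm (suc a) (bound b)⟩,
    ⟨[jTerms a b c], jTerm a (func b d c)⟩,
    ⟨[], jTerms a (lit 0) (atom (lit 0))⟩,
    ⟨[jTerm a c, jTerms a b d], jTerms a (suc b) (node c d)⟩,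
    ⟨[], jForm a falsum⟩,
    ⟨[jTerm a b, jTerm a c], jForm a (equal b c)⟩,
    ⟨[jTerms a b c], jForm a (rel b d c)⟩,
    ⟨[jForm a b, jForm a c], jForm a (imp b c)⟩,
    ⟨[jForm (suc a) b], jForm a (all b)⟩,
    ⟨[jNe a b], jFresh a (free b)⟩,
    ⟨[], jFresh a (bound b)⟩,
    ⟨[], jFresh a (atom b)⟩,
    ⟨[jFresh a b, jFresh a c], jFresh a (node b c)⟩,
    ⟨[], jInst a (free b) (free b)⟩,
    ⟨[], jInst a (bound (lit 0)) a⟩,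
    ⟨[], jInst a (bound (suc b)) (bound b)⟩,
    ⟨[], jInst a (atom b) (atom b)⟩,
    ⟨[jInst a b c, jInst a d f], jInst a (node b d) (node c f)⟩ ]

/-- The rules for lines that verify computations of programs. -/
def evalRules : List Rule :=
  let a := var 0
  let b := var 1
  let c := var 2
  let d := var 3
  let f := var 4
  let g := var 5
  [ ⟨[], jEval pZero a (lit 0)⟩,
    ⟨[], jEval pSucc a (suc a)⟩,
    ⟨[], jEval pLeft (pair a b) a⟩,
    ⟨[], jEval pRight (pair a b) b⟩,
    ⟨[jEval a c d, jEval b c f], jEval (pPair a b) c (pair d f)⟩,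
    ⟨[jEval b c d, jEval a d f], jEval (pComp a b) c f⟩,
    ⟨[jEval a c d], jEval (pPrec a b) (pair c (lit 0)) d⟩,
    ⟨[jEval (pPrec a b) (pair c d) f, jEval b (pair c (pair d f)) g],
      jEval (pPrec a b) (pair c (suc d)) g⟩,
    ⟨[jEval a (pair b c) (lit 0)], jEval (pFind a) (pair b c) c⟩,
    ⟨[jEval a (pair b c) (suc d), jEval (pFind a) (pair b (suc c)) f],
      jEval (pFind a) (pair b c) f⟩ ]

/-- The rules for the lines proper of a derivation: the axioms and rules of the calculus. In the
first rule, a nonlogical axiom is recognized by a computation of the program `e`. -/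
def derRules (e : Nat.Partrec.Code) : List Rule :=
  let a := var 0
  let b := var 1
  let c := var 2
  let d := var 3
  let f := var 4
  [ ⟨[jEval (lit (gProg e)) a (lit 1)], jDer a⟩,
    ⟨[jForm (lit 0) a, jForm (lit 0) b], jDer (imp a (imp b a))⟩,
    ⟨[jForm (lit 0) a, jForm (lit 0) b, jForm (lit 0) c],
      jDer (imp (imp a (imp b c)) (imp (imp a b) (imp a c)))⟩,
    ⟨[jForm (lit 0) a], jDer (imp (imp (imp a falsum) falsum) a)⟩,
    ⟨[jForm (lit 1) a, jTerm (lit 0) b, jInst b a c], jDer (imp (all a) c)⟩,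
    ⟨[jTerm (lit 0) a], jDer (equal a a)⟩,
    ⟨[jTerm (lit 0) a, jTerm (lit 0) b, jForm (lit 1) c, jInst a c d, jInst b c f],
      jDer (imp (equal a b) (imp d f))⟩,
    ⟨[jDer (imp a b), jDer a], jDer b⟩,
    ⟨[jForm (lit 1) b, jFresh d a, jFresh d b, jInst (free d) b c, jDer (imp a c)],
      jDer (imp a (all b))⟩ ]

/-- All rules. -/
def rules (e : Nat.Partrec.Code) : List Rule := sideRules ++ evalRules ++ derRules e

end Rules

/-! ### The proof predicate -/

/-- `p` codes a derivation, from the theory whose axioms are decided by the program `e`, of the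
formula with Gödel number `x`. That is, `p` codes a finite sequence (its length and a code for
the β-function), every line of which follows by one of the rules from earlier lines, and whose
last line says that `x` is derivable. -/
def IsProof (e : Nat.Partrec.Code) (p x : ℕ) : Prop :=
  let len := p.unpair.1
  let s := p.unpair.2
  (∃ i, i + 1 = len ∧ Nat.beta s i = Nat.pair 7 x) ∧
  ∀ i < len, ∃ r ∈ rules e, ∃ v : Fin 6 → ℕ,
    Nat.beta s i = r.concl.eval v ∧ ∀ q ∈ r.prem, ∃ j < i, Nat.beta s j = q.eval v

/-- The formula saying that `y` is the number described by a pattern whose variables have the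
values `v`. -/
def patF : Pat → ∀ {n : ℕ}, (Fin 6 → L.Term (Empty ⊕ Fin n)) → L.Term (Empty ⊕ Fin n) →
    L.BoundedFormula Empty n
  | .var i, _, v, y => y =' v i
  | .lit k, _, _, y => y =' num k
  | .suc a, _, v, y => bex y ((up y =' succ last) ⊓ patF a (fun i => up (v i)) last)
  | .pair a b, n, v, y =>
      bex y (bex (up y)
        (let w : L.Term (Empty ⊕ Fin (n + 2)) := bd (Fin.castSucc (Fin.last n))
         let z : L.Term (Empty ⊕ Fin (n + 2)) := last
         pairF w z (up (up y)) ⊓ patF a (fun i => up (up (v i))) w ⊓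
           patF b (fun i => up (up (v i))) z))

/-- Finite conjunction. -/
def conj {n : ℕ} (l : List (L.BoundedFormula Empty n)) : L.BoundedFormula Empty n :=
  l.foldr (· ⊓ ·) ⊤

/-- Finite disjunction. -/
def disj {n : ℕ} (l : List (L.BoundedFormula Empty n)) : L.BoundedFormula Empty n :=
  l.foldr (· ⊔ ·) ⊥

/-- In the context `p, x, len, s, i, y, v₀, …, v₅` (the variables of index `0` to `11`):
some entry of `s` before the `i`-th one is the number described by the pattern `q`. -/
def premF (q : Pat) : L.BoundedFormula Empty 12 :=
  bex (bd 4) (∼(bd 12 =' bd 4) ⊓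
    bex (bd 3) (betaF (bd 3) (bd 12) (bd 13) ⊓
      patF q ![bd 6, bd 7, bd 8, bd 9, bd 10, bd 11] (bd 13)))

/-- In the same context: `y` follows by the rule `r`, with values `v₀, …, v₅` of its variables,
from entries of `s` before the `i`-th one. -/
def ruleF (r : Rule) : L.BoundedFormula Empty 12 :=
  patF r.concl ![bd 6, bd 7, bd 8, bd 9, bd 10, bd 11] (bd 5) ⊓ conj (r.prem.map premF)

/-- The arithmetical formula `Proof(p, x)`, in which `p` is the variable of index `0` and `x` the
variable of index `1`: the formalization of `IsProof`. All its quantifiers are bounded. -/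
def proofF (e : Nat.Partrec.Code) : L.BoundedFormula Empty 2 :=
  -- `len` and `s` are the variables of index `2` and `3`
  bex (bd 0) (bex (bd 0) (pairF (bd 2) (bd 3) (bd 0) ⊓
    -- the entry `y` (index `5`) at the last place `i` (index `4`) says that `x` is derivable
    bex (bd 2) ((succ (bd 4) =' bd 2) ⊓ bex (bd 3) (betaF (bd 3) (bd 4) (bd 5) ⊓
      patF (Pat.jDer (Pat.var 0)) (fun _ => bd 1) (bd 5))) ⊓
    -- for every `i < len`, the `i`-th entry `y` follows by some rule
    ball (bd 2) ((bd 4 =' bd 2) ⊔ bex (bd 3) (betaF (bd 3) (bd 4) (bd 5) ⊓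
      bex (bd 0) (bex (bd 0) (bex (bd 0) (bex (bd 0) (bex (bd 0) (bex (bd 0)
        (disj ((rules e).map ruleF)))))))))))

/-- The sentence `Proof(m̄, k̄)`. -/
def proofS (e : Nat.Partrec.Code) (m k : ℕ) : L.Sentence := bsub (proofF e) ![num m, num k]

/-- The sentence `0 = 1`. -/
def zeroEqOne : L.Sentence := (num 0 : L.Term (Empty ⊕ Fin 0)) =' num 1

/-- The `n`-th consistency instance `¬ Proof(n̄, ⌜0 = 1⌝)`. -/
def conInst (e : Nat.Partrec.Code) (n : ℕ) : L.Sentence := ∼(proofS e n (gSent zeroEqOne))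

end ConsistencySchema

namespace ConsistencySchema

open FirstOrder.Language (Term BoundedFormula)

/-! ### Calculus of substitutions -/

section Substitution

variable {α : Type} {k m n : ℕ}

/-- Simultaneous substitution of terms for the bound variables of a term. -/
def tsub (f : Fin m → L.Term (α ⊕ Fin n)) (t : L.Term (α ⊕ Fin m)) : L.Term (α ⊕ Fin n) :=
  t.subst (Sum.elim (fun a => .var (Sum.inl a)) f)

@[simp] theorem tsub_bd (f : Fin m → L.Term (α ⊕ Fin n)) (i : Fin m) : tsub f (bd i) = f i := rfl

@[simp] theorem tsub_last (f : Fin m → L.Term (α ⊕ Fin n)) (t : L.Term (α ⊕ Fin n)) :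
    tsub (Fin.snoc f t : Fin (m + 1) → L.Term (α ⊕ Fin n)) last = t := by
  simp [last]

@[simp] theorem tsub_zero (f : Fin m → L.Term (α ⊕ Fin n)) : tsub f zero = zero := by
  simp only [tsub, zero, Term.subst]
  congr 1
  exact funext fun i => i.elim0

@[simp] theorem tsub_succ (f : Fin m → L.Term (α ⊕ Fin n)) (t) :
    tsub f (succ t) = succ (tsub f t) := by
  simp only [tsub, succ, Term.subst]
  congr 1
  exact funext fun i => by fin_cases i; rfl

@[simp] theorem tsub_add (f : Fin m → L.Term (α ⊕ Fin n)) (t s) :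
    tsub f (add t s) = add (tsub f t) (tsub f s) := by
  simp only [tsub, add, Term.subst]
  congr 1
  exact funext fun i => by fin_cases i <;> rfl

@[simp] theorem tsub_mul (f : Fin m → L.Term (α ⊕ Fin n)) (t s) :
    tsub f (mul t s) = mul (tsub f t) (tsub f s) := by
  simp only [tsub, mul, Term.subst]
  congr 1
  exact funext fun i => by fin_cases i <;> rfl

@[simp] theorem up_bd (i : Fin n) : up (bd i : L.Term (α ⊕ Fin n)) = bd i.castSucc := rfl

@[simp] theorem up_zero : up (zero : L.Term (α ⊕ Fin n)) = zero := by
  simp only [up, zero, Term.relabel]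
  congr 1
  exact funext fun i => i.elim0

@[simp] theorem up_succ (t : L.Term (α ⊕ Fin n)) : up (succ t) = succ (up t) := by
  simp only [up, succ, Term.relabel]
  congr 1
  exact funext fun i => by fin_cases i; rfl

@[simp] theorem up_add (t s : L.Term (α ⊕ Fin n)) : up (add t s) = add (up t) (up s) := by
  simp only [up, add, Term.relabel]
  congr 1
  exact funext fun i => by fin_cases i <;> rfl

@[simp] theorem up_mul (t s : L.Term (α ⊕ Fin n)) : up (mul t s) = mul (up t) (up s) := by
  simp only [up, mul, Term.relabel]
  congr 1
  exact funext fun i => by fin_cases i <;> rfl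

@[simp] theorem tsub_snoc_up (f : Fin m → L.Term (α ⊕ Fin n)) (x : L.Term (α ⊕ Fin n))
    (t : L.Term (α ⊕ Fin m)) :
    tsub (Fin.snoc f x : Fin (m + 1) → L.Term (α ⊕ Fin n)) (up t) = tsub f t := by
  induction t with
  | var a => rcases a with a | i <;> simp [tsub, up, Term.relabel, Term.subst]
  | func g ts ih => simpa [tsub, up, Term.relabel, Term.subst, funext_iff] using ih

theorem up_tsub (f : Fin m → L.Term (α ⊕ Fin n)) (t : L.Term (α ⊕ Fin m)) :
    up (tsub f t) = tsub (fun i => up (f i)) t := by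
  induction t with
  | var a => rcases a with a | i <;> simp [tsub, up, Term.relabel, Term.subst]
  | func g ts ih => simpa [tsub, up, Term.relabel, Term.subst, funext_iff] using ih

theorem tsub_tsub (g : Fin m → L.Term (α ⊕ Fin n)) (f : Fin k → L.Term (α ⊕ Fin m))
    (t : L.Term (α ⊕ Fin k)) : tsub g (tsub f t) = tsub (fun i => tsub g (f i)) t := by
  induction t with
  | var a => rcases a with a | i <;> simp [tsub, Term.subst]
  | func h ts ih => simpa [tsub, Term.subst, funext_iff] using ih

@[simp] theorem tsub_id (t : L.Term (α ⊕ Fin n)) : tsub bd t = t := by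
  induction t with
  | var a => rcases a with a | i <;> rfl
  | func h ts ih => simpa [tsub, Term.subst, funext_iff] using ih

@[simp] theorem tsub_level_zero (f : Fin 0 → L.Term (α ⊕ Fin 0)) (t : L.Term (α ⊕ Fin 0)) :
    tsub f t = t := by
  rw [Subsingleton.elim f bd, tsub_id]

@[simp] theorem bsub_bdEqual (f : Fin m → L.Term (α ⊕ Fin n)) (t s : L.Term (α ⊕ Fin m)) :
    bsub (t =' s) f = (tsub f t =' tsub f s) := rfl

@[simp] theorem bsub_le (f : Fin m → L.Term (α ⊕ Fin n)) (t s : L.Term (α ⊕ Fin m)) :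
    bsub (le t s) f = le (tsub f t) (tsub f s) := by
  simp only [le, bsub]
  congr 1
  exact funext fun i => by fin_cases i <;> rfl

@[simp] theorem bsub_imp (f : Fin m → L.Term (α ⊕ Fin n)) (φ ψ : L.BoundedFormula α m) :
    bsub (φ ⟹ ψ) f = (bsub φ f ⟹ bsub ψ f) := rfl

@[simp] theorem bsub_not (f : Fin m → L.Term (α ⊕ Fin n)) (φ : L.BoundedFormula α m) :
    bsub (∼φ) f = ∼(bsub φ f) := rfl

@[simp] theorem bsub_inf (f : Fin m → L.Term (α ⊕ Fin n)) (φ ψ : L.BoundedFormula α m) :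
    bsub (φ ⊓ ψ) f = (bsub φ f ⊓ bsub ψ f) := rfl

theorem bsub_ex (f : Fin m → L.Term (α ⊕ Fin n)) (φ : L.BoundedFormula α (m + 1)) :
    bsub (∃' φ) f = ∃' (bsub φ (Fin.snoc (fun i => up (f i)) last)) := rfl

theorem bsub_bsub {k : ℕ} (φ : L.BoundedFormula α k) : ∀ {m n : ℕ}
    (f : Fin k → L.Term (α ⊕ Fin m)) (g : Fin m → L.Term (α ⊕ Fin n)),
    bsub (bsub φ f) g = bsub φ (fun i => tsub g (f i)) := by
  induction φ with
  | falsum => intros; rfl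
  | equal t s =>
    intro m n f g
    exact congrArg₂ BoundedFormula.equal (tsub_tsub g f t) (tsub_tsub g f s)
  | rel R ts =>
    intro m n f g
    exact congrArg (BoundedFormula.rel R) (funext fun i => tsub_tsub g f (ts i))
  | imp φ ψ h₁ h₂ =>
    intro m n f g
    exact congrArg₂ BoundedFormula.imp (h₁ f g) (h₂ f g)
  | all φ ih =>
    intro m n f g
    refine congrArg BoundedFormula.all ((ih _ _).trans (congrArg (bsub φ) (funext fun i => ?_)))
    refine Fin.lastCases ?_ (fun i => ?_) i
    · simp
    · simp [up_tsub]

/-- Substitution under a quantifier followed by instantiation. -/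
theorem inst_bsub (φ : L.BoundedFormula α (m + 1)) (f : Fin m → L.Term (α ⊕ Fin 0))
    (t : L.Term (α ⊕ Fin 0)) :
    inst (bsub φ (Fin.snoc (fun i => up (f i)) last)) t = bsub φ (Fin.snoc f t) := by
  rw [inst, bsub_bsub]
  refine congrArg (bsub φ) (funext fun i => ?_)
  have h : (fun _ : Fin 1 => t) = Fin.snoc (Fin.elim0 : Fin 0 → L.Term (α ⊕ Fin 0)) t :=
    funext fun i => by fin_cases i; rfl
  refine Fin.lastCases ?_ (fun i => ?_) i
  · simp [h]
  · simp [h]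

/-- Instantiation of an explicitly given formula. -/
theorem inst_eq (φ : L.BoundedFormula α 1) (t : L.Term (α ⊕ Fin 0)) :
    inst φ t = bsub φ (Fin.snoc (Fin.elim0 : Fin 0 → L.Term (α ⊕ Fin 0)) t) :=
  congrArg (bsub φ) (funext fun i => by fin_cases i; rfl)

end Substitution

/-! ### Free variables -/

section FreeVariables

variable {m n : ℕ}

theorem notMem_varFinsetLeft_tsub {i : ℕ} (f : Fin m → L.Term (ℕ ⊕ Fin n))
    (t : L.Term (ℕ ⊕ Fin m)) (ht : i ∉ t.varFinsetLeft) (hf : ∀ j, i ∉ (f j).varFinsetLeft) :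
    i ∉ (tsub f t).varFinsetLeft := by
  induction t with
  | var a =>
    rcases a with a | j
    · exact ht
    · exact hf j
  | func g ts ih =>
    simp only [tsub, Term.subst, Term.varFinsetLeft, Finset.mem_biUnion, Finset.mem_univ, true_and,
      not_exists] at ht ih ⊢
    exact fun j => ih j (ht j)

@[simp] theorem varFinsetLeft_up (t : L.Term (ℕ ⊕ Fin n)) :
    (up t).varFinsetLeft = t.varFinsetLeft := by
  induction t with
  | var a => rcases a with a | j <;> rfl
  | func g ts ih =>
    simp only [up, Term.relabel, Term.varFinsetLeft] at ih ⊢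
    exact Finset.biUnion_congr rfl fun j _ => ih j

@[simp] theorem varFinsetLeft_bd (i : Fin n) :
    (bd i : L.Term (ℕ ⊕ Fin n)).varFinsetLeft = ∅ := rfl

@[simp] theorem varFinsetLeft_last :
    (last : L.Term (ℕ ⊕ Fin (n + 1))).varFinsetLeft = ∅ := rfl

@[simp] theorem varFinsetLeft_fvar (i : ℕ) : (fvar i).varFinsetLeft = {i} := rfl

@[simp] theorem varFinsetLeft_zero : (zero : L.Term (ℕ ⊕ Fin n)).varFinsetLeft = ∅ := rfl

@[simp] theorem varFinsetLeft_succ (t : L.Term (ℕ ⊕ Fin n)) :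
    (succ t).varFinsetLeft = t.varFinsetLeft := by
  ext i
  simp [succ, Term.varFinsetLeft]

@[simp] theorem varFinsetLeft_add (t s : L.Term (ℕ ⊕ Fin n)) :
    (add t s).varFinsetLeft = t.varFinsetLeft ∪ s.varFinsetLeft := by
  ext i
  simp [add, Term.varFinsetLeft]

@[simp] theorem varFinsetLeft_num (k : ℕ) : (num k : L.Term (ℕ ⊕ Fin n)).varFinsetLeft = ∅ := by
  induction k with
  | zero => rfl
  | succ k ih => simp only [num, varFinsetLeft_succ, ih]

theorem notMem_freeVarFinset_bsub {i : ℕ} (φ : L.BoundedFormula ℕ m) : ∀ {n : ℕ}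
    (f : Fin m → L.Term (ℕ ⊕ Fin n)), i ∉ φ.freeVarFinset → (∀ j, i ∉ (f j).varFinsetLeft) →
    i ∉ (bsub φ f).freeVarFinset := by
  induction φ with
  | falsum => intro n f h _; exact h
  | equal t s =>
    intro n f h hf
    simp only [bsub, BoundedFormula.freeVarFinset, Finset.mem_union, not_or] at h ⊢
    exact ⟨notMem_varFinsetLeft_tsub f t h.1 hf, notMem_varFinsetLeft_tsub f s h.2 hf⟩
  | rel R ts =>
    intro n f h hf
    simp only [bsub, BoundedFormula.freeVarFinset, Finset.mem_biUnion, Finset.mem_univ, true_and,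
      not_exists] at h ⊢
    exact fun j => notMem_varFinsetLeft_tsub f (ts j) (h j) hf
  | imp φ ψ h₁ h₂ =>
    intro n f h hf
    simp only [bsub, BoundedFormula.freeVarFinset, Finset.mem_union, not_or] at h ⊢
    exact ⟨h₁ f h.1 hf, h₂ f h.2 hf⟩
  | all φ ih =>
    intro n f h hf
    refine ih _ h fun j => ?_
    refine Fin.lastCases ?_ (fun j => ?_) j
    · simp
    · simpa using hf j

end FreeVariables

/-! ### Sentences seen as formulas without free variables -/

section Embedding

variable {m n : ℕ}

/-- A term without free variables, seen as a term with free variables `x₀, x₁, …`. -/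
def tembed (t : L.Term (Empty ⊕ Fin n)) : L.Term (ℕ ⊕ Fin n) :=
  t.subst (Sum.elim (Term.relabel Sum.inl ∘ fun a : Empty => a.elim) (Term.var ∘ Sum.inr))

/-- A formula without free variables, seen as a formula with free variables `x₀, x₁, …`. -/
def bembed (φ : L.BoundedFormula Empty n) : L.BoundedFormula ℕ n := φ.subst fun a : Empty => a.elim

@[simp] theorem tembed_bd (i : Fin n) : tembed (bd i) = bd i := rfl

@[simp] theorem tembed_last : tembed (last : L.Term (Empty ⊕ Fin (n + 1))) = last := rfl

@[simp] theorem tembed_zero : tembed (zero : L.Term (Empty ⊕ Fin n)) = zero := by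
  simp only [tembed, zero, Term.subst]
  congr 1
  exact funext fun i => i.elim0

@[simp] theorem tembed_succ (t : L.Term (Empty ⊕ Fin n)) :
    tembed (succ t) = succ (tembed t) := by
  simp only [tembed, succ, Term.subst]
  congr 1
  exact funext fun i => by fin_cases i; rfl

@[simp] theorem tembed_add (t s : L.Term (Empty ⊕ Fin n)) :
    tembed (add t s) = add (tembed t) (tembed s) := by
  simp only [tembed, add, Term.subst]
  congr 1
  exact funext fun i => by fin_cases i <;> rfl

@[simp] theorem tembed_mul (t s : L.Term (Empty ⊕ Fin n)) :
    tembed (mul t s) = mul (tembed t) (tembed s) := by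
  simp only [tembed, mul, Term.subst]
  congr 1
  exact funext fun i => by fin_cases i <;> rfl

@[simp] theorem tembed_num (j : ℕ) : tembed (num j : L.Term (Empty ⊕ Fin n)) = num j := by
  induction j with
  | zero => exact tembed_zero
  | succ j ih => simp only [num, tembed_succ, ih]

theorem tembed_up (t : L.Term (Empty ⊕ Fin n)) : tembed (up t) = up (tembed t) := by
  induction t with
  | var a => rcases a with a | i <;> [exact a.elim; rfl]
  | func g ts ih => simpa [tembed, up, Term.relabel, Term.subst, funext_iff] using ih

theorem tembed_tsub (f : Fin m → L.Term (Empty ⊕ Fin n)) (t : L.Term (Empty ⊕ Fin m)) :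
    tembed (tsub f t) = tsub (fun i => tembed (f i)) (tembed t) := by
  induction t with
  | var a => rcases a with a | i <;> [exact a.elim; rfl]
  | func g ts ih => simpa [tembed, tsub, Term.subst, funext_iff] using ih

@[simp] theorem bembed_bdEqual (t s : L.Term (Empty ⊕ Fin n)) :
    bembed (t =' s) = (tembed t =' tembed s) := rfl

@[simp] theorem bembed_le (t s : L.Term (Empty ⊕ Fin n)) :
    bembed (le t s) = le (tembed t) (tembed s) := by
  simp only [le, bembed, BoundedFormula.subst, BoundedFormula.mapTermRel, id]
  congr 1
  exact funext fun i => by fin_cases i <;> rfl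

@[simp] theorem bembed_imp (φ ψ : L.BoundedFormula Empty n) :
    bembed (φ ⟹ ψ) = (bembed φ ⟹ bembed ψ) := rfl

@[simp] theorem bembed_not (φ : L.BoundedFormula Empty n) : bembed (∼φ) = ∼(bembed φ) := rfl

@[simp] theorem bembed_inf (φ ψ : L.BoundedFormula Empty n) :
    bembed (φ ⊓ ψ) = (bembed φ ⊓ bembed ψ) := rfl

@[simp] theorem bembed_all (φ : L.BoundedFormula Empty (n + 1)) :
    bembed (∀' φ) = ∀' (bembed φ) := rfl

@[simp] theorem bembed_ex (φ : L.BoundedFormula Empty (n + 1)) :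
    bembed (∃' φ) = ∃' (bembed φ) := rfl

theorem bembed_bsub (φ : L.BoundedFormula Empty m) : ∀ {n : ℕ}
    (f : Fin m → L.Term (Empty ⊕ Fin n)),
    bembed (bsub φ f) = bsub (bembed φ) fun i => tembed (f i) := by
  induction φ with
  | falsum => intros; rfl
  | equal t s =>
    intro n f
    exact congrArg₂ BoundedFormula.equal (tembed_tsub f t) (tembed_tsub f s)
  | rel R ts =>
    intro n f
    exact congrArg (BoundedFormula.rel R) (funext fun i => tembed_tsub f (ts i))
  | imp φ ψ h₁ h₂ =>
    intro n f
    exact congrArg₂ BoundedFormula.imp (h₁ f) (h₂ f)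
  | all φ ih =>
    intro n f
    refine congrArg BoundedFormula.all ((ih _).trans (congrArg (bsub (bembed φ))
      (funext fun i => ?_)))
    refine Fin.lastCases ?_ (fun i => ?_) i
    · simp [last]
    · simp [tembed_up]

theorem varFinsetLeft_tembed (t : L.Term (Empty ⊕ Fin n)) : (tembed t).varFinsetLeft = ∅ := by
  induction t with
  | var a => rcases a with a | i <;> [exact a.elim; rfl]
  | func g ts ih =>
    refine Finset.eq_empty_of_forall_notMem fun i => ?_
    simp only [tembed, Term.subst, Term.varFinsetLeft, Finset.mem_biUnion, Finset.mem_univ,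
      true_and, not_exists] at ih ⊢
    intro j
    rw [ih j]
    simp

theorem freeVarFinset_bembed (φ : L.BoundedFormula Empty n) : (bembed φ).freeVarFinset = ∅ := by
  induction φ with
  | falsum => rfl
  | equal t s =>
    exact (congrArg₂ (· ∪ ·) (varFinsetLeft_tembed t) (varFinsetLeft_tembed s)).trans
      (Finset.union_empty _)
  | rel R ts =>
    refine Finset.eq_empty_of_forall_notMem fun i hi => ?_
    obtain ⟨j, -, hj⟩ := Finset.mem_biUnion.1 hi
    have h : i ∈ (tembed (ts j)).varFinsetLeft := hj
    simp [varFinsetLeft_tembed] at h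
  | imp φ ψ h₁ h₂ =>
    exact (congrArg₂ (· ∪ ·) h₁ h₂).trans (Finset.union_empty _)
  | all φ ih => exact ih

end Embedding

/-! ### Derivations from hypotheses -/

/-- Derivability of a formula from a theory and a list of hypotheses. -/
def Der (T : L.Theory) : List (L.BoundedFormula ℕ 0) → L.BoundedFormula ℕ 0 → Prop
  | [], φ => Derivable T φ
  | χ :: Γ, φ => Der T Γ (χ ⟹ φ)

namespace Der

variable {T : L.Theory} {Γ : List (L.BoundedFormula ℕ 0)} {φ ψ χ : L.BoundedFormula ℕ 0}

theorem of : ∀ {Γ : List (L.BoundedFormula ℕ 0)} {φ : L.BoundedFormula ℕ 0},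
    Derivable T φ → Der T Γ φ
  | [], _, h => h
  | χ :: Γ, φ, h => of (Γ := Γ) (.mp φ (χ ⟹ φ) (.weak φ χ) h)

theorem mp : ∀ {Γ : List (L.BoundedFormula ℕ 0)} {φ ψ : L.BoundedFormula ℕ 0},
    Der T Γ (φ ⟹ ψ) → Der T Γ φ → Der T Γ ψ
  | [], _, _, h₁, h₂ => Derivable.mp _ _ h₁ h₂
  | χ :: Γ, φ, ψ, h₁, h₂ =>
    mp (Γ := Γ) (φ := χ ⟹ φ) (ψ := χ ⟹ ψ)
      (mp (Γ := Γ) (φ := χ ⟹ (φ ⟹ ψ)) (ψ := (χ ⟹ φ) ⟹ (χ ⟹ ψ)) (of (.frege χ φ ψ)) h₁) h₂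

theorem intro (h : Der T (φ :: Γ) ψ) : Der T Γ (φ ⟹ ψ) := h

theorem lift (h : Der T Γ φ) : Der T (χ :: Γ) φ := mp (Γ := Γ) (of (.weak φ χ)) h

theorem hyp : Der T (φ :: Γ) φ :=
  mp (Γ := Γ) (mp (Γ := Γ) (of (.frege φ (φ ⟹ φ) φ)) (of (.weak φ (φ ⟹ φ)))) (of (.weak φ φ))

theorem hyp₁ : Der T (χ :: φ :: Γ) φ := hyp.lift

theorem efq (h : Der T Γ ⊥) : Der T Γ φ :=
  mp (of (.dne φ)) (intro h.lift)

theorem absurd (h₁ : Der T Γ ∼φ) (h₂ : Der T Γ φ) : Der T Γ ψ := (mp h₁ h₂).efq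

theorem cases (h₁ : Der T (φ :: Γ) ψ) (h₂ : Der T (∼φ :: Γ) ψ) : Der T Γ ψ :=
  mp (of (.dne ψ)) <| intro <| mp hyp <| mp h₂.intro.lift <| intro <|
    mp hyp₁ <| mp h₁.intro.lift.lift hyp

theorem inf_left (h : Der T Γ (φ ⊓ ψ)) : Der T Γ φ :=
  mp (of (.dne φ)) <| intro <| mp h.lift <| intro <| absurd hyp₁ hyp

theorem inf_right (h : Der T Γ (φ ⊓ ψ)) : Der T Γ ψ :=
  mp (of (.dne ψ)) <| intro <| mp h.lift <| intro hyp₁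

/-! #### Quantifiers -/

theorem spec {φ : L.BoundedFormula ℕ 1} (h : Der T Γ (∀' φ)) (t) : Der T Γ (inst φ t) :=
  mp (of (.spec φ t)) h

theorem ex_intro {φ : L.BoundedFormula ℕ 1} (t) (h : Der T Γ (inst φ t)) : Der T Γ (∃' φ) :=
  intro <| mp (spec (φ := ∼φ) hyp t) h.lift

theorem ex_elim {φ : L.BoundedFormula ℕ 1} (i : ℕ) (hφ : i ∉ φ.freeVarFinset)
    (hψ : i ∉ ψ.freeVarFinset) (h : Der T [] (inst φ (fvar i) ⟹ ψ)) :
    Der T [] (∃' φ ⟹ ψ) := by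
  have h₁ : Der T [∼ψ] (inst (∼φ) (fvar i)) := intro <| mp hyp₁ <| mp h.lift.lift hyp
  have h₂ : Der T [∼ψ] (∀' ∼φ) :=
    .gen (∼ψ) (∼φ) i
      (by simpa [BoundedFormula.not, BoundedFormula.freeVarFinset, Bot.bot] using hψ)
      (by simpa [BoundedFormula.not, BoundedFormula.freeVarFinset, Bot.bot] using hφ) h₁
  exact intro <| mp (of (.dne ψ)) <| intro <| mp hyp₁ (mp h₂.intro.lift.lift hyp)

theorem spec_bsub {m : ℕ} {φ : L.BoundedFormula ℕ (m + 1)} {f : Fin m → L.Term (ℕ ⊕ Fin 0)}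
    (h : Der T Γ (bsub (∀' φ) f)) (t) : Der T Γ (bsub φ (Fin.snoc f t)) :=
  inst_bsub φ f t ▸ h.spec t

theorem gen_bsub {m : ℕ} {φ : L.BoundedFormula ℕ (m + 1)} {f : Fin m → L.Term (ℕ ⊕ Fin 0)}
    (i : ℕ) (hφ : i ∉ φ.freeVarFinset) (hf : ∀ j, i ∉ (f j).varFinsetLeft)
    (h : Der T [] (bsub φ (Fin.snoc f (fvar i)))) : Der T [] (bsub (∀' φ) f) := by
  refine mp (Γ := []) (φ := ⊤) (.gen ⊤ _ i (fun h => ?_) ?_ ?_) (intro hyp)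
  · simp [BoundedFormula.freeVarFinset] at h
  · refine notMem_freeVarFinset_bsub φ _ hφ fun j => ?_
    refine Fin.lastCases ?_ (fun j => ?_) j
    · simp
    · simpa using hf j
  · rw [inst_bsub]
    exact h.lift

theorem spec₁ {φ : L.BoundedFormula ℕ 1} (h : Der T Γ (∀' φ)) (x) :
    Der T Γ (bsub φ (Fin.snoc (Fin.elim0 : Fin 0 → L.Term (ℕ ⊕ Fin 0)) x)) :=
  inst_eq φ x ▸ h.spec x

theorem spec₂ {φ : L.BoundedFormula ℕ 2} (h : Der T Γ (∀' ∀' φ)) (x y) :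
    Der T Γ (bsub φ (Fin.snoc
      (Fin.snoc (Fin.elim0 : Fin 0 → L.Term (ℕ ⊕ Fin 0)) x : Fin 1 → L.Term (ℕ ⊕ Fin 0)) y)) :=
  spec_bsub (h.spec₁ x) y

/-! #### Equality -/

variable {s t u : L.Term (ℕ ⊕ Fin 0)}

theorem refl (t) : Der T Γ (t =' t) := of (.refl t)

theorem leib (φ : L.BoundedFormula ℕ 1) (h : Der T Γ (t =' s)) (h' : Der T Γ (inst φ t)) :
    Der T Γ (inst φ s) :=
  mp (mp (of (.leib t s φ)) h) h'

theorem leib_bsub {m : ℕ} {φ : L.BoundedFormula ℕ (m + 1)} {f : Fin m → L.Term (ℕ ⊕ Fin 0)}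
    (h : Der T Γ (t =' s)) (h' : Der T Γ (bsub φ (Fin.snoc f t))) :
    Der T Γ (bsub φ (Fin.snoc f s)) := by
  rw [← inst_bsub] at h' ⊢
  exact leib _ h h'

theorem symm (h : Der T Γ (t =' s)) : Der T Γ (s =' t) := by
  simpa [inst_eq] using leib (last =' up t) h (by simpa [inst_eq] using refl t)

theorem trans (h : Der T Γ (t =' s)) (h' : Der T Γ (s =' u)) : Der T Γ (t =' u) := by
  simpa [inst_eq] using leib (up t =' last) h' (by simpa [inst_eq] using h)

theorem congr_succ (h : Der T Γ (t =' s)) : Der T Γ (succ t =' succ s) := by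
  simpa [inst_eq] using leib (up (succ t) =' succ last) h (by simpa [inst_eq] using refl (succ t))

theorem congr_add_left (h : Der T Γ (t =' s)) : Der T Γ (add t u =' add s u) := by
  simpa [inst_eq] using
    leib (up (add t u) =' add last (up u)) h (by simpa [inst_eq] using refl (add t u))

theorem congr_add_right (h : Der T Γ (t =' s)) : Der T Γ (add u t =' add u s) := by
  simpa [inst_eq] using
    leib (up (add u t) =' add (up u) last) h (by simpa [inst_eq] using refl (add u t))

theorem congr_mul_left (h : Der T Γ (t =' s)) : Der T Γ (mul t u =' mul s u) := by
  simpa [inst_eq] using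
    leib (up (mul t u) =' mul last (up u)) h (by simpa [inst_eq] using refl (mul t u))

theorem congr_mul_right (h : Der T Γ (t =' s)) : Der T Γ (mul u t =' mul u s) := by
  simpa [inst_eq] using
    leib (up (mul u t) =' mul (up u) last) h (by simpa [inst_eq] using refl (mul u t))

theorem congr_le_left (h : Der T Γ (t =' s)) (h' : Der T Γ (le t u)) : Der T Γ (le s u) := by
  simpa [inst_eq] using leib (le last (up u)) h (by simpa [inst_eq] using h')

theorem congr_le_right (h : Der T Γ (t =' s)) (h' : Der T Γ (le u t)) : Der T Γ (le u s) := by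
  simpa [inst_eq] using leib (le (up u) last) h (by simpa [inst_eq] using h')

end Der

/-- Derivability is transitive. -/
theorem Derivable.of_extends {T U : L.Theory} (h : Extends T U) {φ : L.BoundedFormula ℕ 0}
    (hφ : Derivable U φ) : Derivable T φ := by
  induction hφ with
  | ax σ hσ => exact h σ hσ
  | weak φ ψ => exact .weak φ ψ
  | frege φ ψ χ => exact .frege φ ψ χ
  | dne φ => exact .dne φ
  | spec φ t => exact .spec φ t
  | refl t => exact .refl t
  | leib t s φ => exact .leib t s φ
  | mp φ ψ _ _ h₁ h₂ => exact .mp φ ψ h₁ h₂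
  | gen χ φ i hχ hφ _ ih => exact .gen χ φ i hχ hφ ih

/-! ### The theory of successor, addition, multiplication and order -/

namespace EA

open Der

variable {Γ : List (L.BoundedFormula ℕ 0)} {x y z : L.Term (ℕ ⊕ Fin 0)}

theorem der_axiom {σ : L.Sentence} (h : AxiomEA σ) : Der EA Γ (embed σ) := of (.ax σ h)

theorem succ_ne_zero (x) : Der EA Γ ∼(succ x =' zero) := by
  simpa [Fin.snoc] using spec₁ (φ := bembed (∼(succ (bd 0) =' zero))) (der_axiom .succ_ne_zero) x

theorem succ_inj (h : Der EA Γ (succ x =' succ y)) : Der EA Γ (x =' y) := by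
  refine mp ?_ h
  simpa [Fin.snoc] using
    spec₂ (φ := bembed ((succ (bd 0) =' succ (bd 1)) ⟹ (bd 0 =' bd 1))) (der_axiom .succ_inj) x y

theorem zero_or_succ (x) : Der EA Γ (∼(x =' zero) ⟹ ∃' (up x =' succ last)) := by
  simpa [Fin.snoc, bsub_ex] using
    spec₁ (φ := bembed (∼(bd 0 =' zero) ⟹ ∃' (bd 0 =' succ (bd 1)))) (der_axiom .zero_or_succ) x

theorem add_zero (x) : Der EA Γ (add x zero =' x) := by
  simpa [Fin.snoc] using spec₁ (φ := bembed (add (bd 0) zero =' bd 0)) (der_axiom .add_zero) x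

theorem add_succ (x y) : Der EA Γ (add x (succ y) =' succ (add x y)) := by
  simpa [Fin.snoc] using
    spec₂ (φ := bembed (add (bd 0) (succ (bd 1)) =' succ (add (bd 0) (bd 1))))
      (der_axiom .add_succ) x y

theorem mul_zero (x) : Der EA Γ (mul x zero =' zero) := by
  simpa [Fin.snoc] using spec₁ (φ := bembed (mul (bd 0) zero =' zero)) (der_axiom .mul_zero) x

theorem mul_succ (x y) : Der EA Γ (mul x (succ y) =' add (mul x y) x) := by
  simpa [Fin.snoc] using
    spec₂ (φ := bembed (mul (bd 0) (succ (bd 1)) =' add (mul (bd 0) (bd 1)) (bd 0)))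
      (der_axiom .mul_succ) x y

theorem le_iff (x y) :
    Der EA Γ ((le x y ⟹ ∃' (add last (up x) =' up y)) ⊓ (∃' (add last (up x) =' up y) ⟹ le x y)) := by
  simpa [Fin.snoc, bsub_ex, BoundedFormula.iff] using
    spec₂ (φ := bembed (le (bd 0) (bd 1) ⇔ ∃' (add (bd 2) (bd 0) =' bd 1)))
      (der_axiom .le_def) x y

end EA

/-! ### The standard model -/

/-- The standard interpretation of the symbols of arithmetic. -/
instance standardModel : L.Structure ℕ where
  funMap := fun {n} (f : ℕ) v => match n, f, v with
    | 0, 0, _ => 0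
    | 1, 0, v => v 0 + 1
    | 2, 0, v => v 0 + v 1
    | 2, 1, v => v 0 * v 1
    | _, _, _ => 0
  RelMap := fun {n} (R : ℕ) v => match n, R, v with
    | 2, 0, v => v 0 ≤ v 1
    | _, _, _ => False

section StandardModel

variable {α : Type} {n : ℕ}

@[simp] theorem realize_zero (v : α → ℕ) : (zero : L.Term α).realize v = 0 := rfl

@[simp] theorem realize_succ (v : α → ℕ) (t : L.Term α) :
    (succ t).realize v = t.realize v + 1 := rfl

@[simp] theorem realize_add (v : α → ℕ) (t s : L.Term α) :
    (add t s).realize v = t.realize v + s.realize v := rfl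

@[simp] theorem realize_mul (v : α → ℕ) (t s : L.Term α) :
    (mul t s).realize v = t.realize v * s.realize v := rfl

@[simp] theorem realize_num (v : α → ℕ) (k : ℕ) : (num k : L.Term α).realize v = k := by
  induction k with
  | zero => rfl
  | succ k ih => simp [num, ih]

@[simp] theorem realize_bd (u : α → ℕ) (v : Fin n → ℕ) (i : Fin n) :
    (bd i : L.Term (α ⊕ Fin n)).realize (Sum.elim u v) = v i := rfl

@[simp] theorem realize_last (u : α → ℕ) (v : Fin n → ℕ) (x : ℕ) :
    (last : L.Term (α ⊕ Fin (n + 1))).realize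
      (Sum.elim u (Fin.snoc v x : Fin (n + 1) → ℕ)) = x := by
  simp [last]

@[simp] theorem realize_up (u : α → ℕ) (v : Fin n → ℕ) (x : ℕ) (t : L.Term (α ⊕ Fin n)) :
    (up t).realize (Sum.elim u (Fin.snoc v x : Fin (n + 1) → ℕ)) =
      t.realize (Sum.elim u v) := by
  rw [up, Term.realize_relabel]
  congr 1
  ext a
  rcases a with a | i <;> simp

@[simp] theorem realize_le (u : α → ℕ) (v : Fin n → ℕ) (t s : L.Term (α ⊕ Fin n)) :
    (le t s).Realize u v ↔ t.realize (Sum.elim u v) ≤ s.realize (Sum.elim u v) := Iff.rfl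

@[simp] theorem realize_ball (u : α → ℕ) (v : Fin n → ℕ) (t : L.Term (α ⊕ Fin n))
    (φ : L.BoundedFormula α (n + 1)) :
    (ball t φ).Realize u v ↔ ∀ x ≤ t.realize (Sum.elim u v), φ.Realize u (Fin.snoc v x) := by
  simp [ball]

@[simp] theorem realize_bex (u : α → ℕ) (v : Fin n → ℕ) (t : L.Term (α ⊕ Fin n))
    (φ : L.BoundedFormula α (n + 1)) :
    (bex t φ).Realize u v ↔ ∃ x ≤ t.realize (Sum.elim u v), φ.Realize u (Fin.snoc v x) := by
  simp [bex]

end StandardModel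

/-! ### Elementary arithmetic decides closed bounded formulas -/

namespace EA

open Der

variable {Γ : List (L.BoundedFormula ℕ 0)} {x y z : L.Term (ℕ ⊕ Fin 0)} {n : ℕ}

theorem add_num (a : ℕ) : ∀ b : ℕ, Der EA Γ (add (num a) (num b) =' num (a + b))
  | 0 => add_zero _
  | b + 1 => (add_succ _ _).trans (add_num a b).congr_succ

theorem mul_num (a : ℕ) : ∀ b : ℕ, Der EA Γ (mul (num a) (num b) =' num (a * b))
  | 0 => mul_zero _
  | b + 1 => ((mul_succ _ _).trans (mul_num a b).congr_add_left).trans (add_num (a * b) a)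

theorem num_ne : ∀ {a b : ℕ}, a ≠ b → Der EA Γ ∼(num a =' num b)
  | 0, 0, h => (h rfl).elim
  | _ + 1, 0, _ => succ_ne_zero _
  | 0, _ + 1, _ => intro ((succ_ne_zero _).mp hyp.symm)
  | a + 1, b + 1, h => intro ((num_ne (a := a) (b := b) fun e => h (e ▸ rfl)).lift.mp (succ_inj hyp))

theorem le_of_add (h : Der EA Γ (add z x =' y)) : Der EA Γ (le x y) :=
  (le_iff x y).inf_right.mp (ex_intro z (by simpa [inst_eq] using h))

theorem le_num {a b : ℕ} (h : a ≤ b) : Der EA Γ (le (num a) (num b)) := by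
  have := le_of_add (add_num (Γ := Γ) (b - a) a)
  rwa [Nat.sub_add_cancel h] at this

theorem le_cases {x y : L.Term (ℕ ⊕ Fin 0)} {ψ : L.BoundedFormula ℕ 0}
    (h₀ : Der EA [x =' zero] ψ)
    (h : ∀ i j, Der EA [succ (add (fvar i) (fvar j)) =' y, x =' succ (fvar j)] ψ) :
    Der EA [] (le x y ⟹ ψ) := by
  suffices H : Der EA [] ((∃' (add last (up x) =' up y)) ⟹ ψ) from
    intro <| H.lift.mp <| (le_iff x y).inf_left.mp hyp
  obtain ⟨i, hi⟩ := Infinite.exists_notMem_finset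
    (x.varFinsetLeft ∪ y.varFinsetLeft ∪ ψ.freeVarFinset)
  obtain ⟨j, hj⟩ := Infinite.exists_notMem_finset
    ({i} ∪ x.varFinsetLeft ∪ y.varFinsetLeft ∪ ψ.freeVarFinset)
  simp only [Finset.mem_union, Finset.mem_singleton, not_or] at hi hj
  refine ex_elim i ?_ hi.2 ?_
  · simpa [Term.bdEqual, BoundedFormula.freeVarFinset] using hi.1
  · have H : Der EA [] ((∃' (up x =' succ last)) ⟹ ((add (fvar i) x =' y) ⟹ ψ)) := by
      refine ex_elim j ?_ ?_ ?_
      · simpa [Term.bdEqual, BoundedFormula.freeVarFinset] using hj.1.1.2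
      · simpa [Term.bdEqual, BoundedFormula.freeVarFinset, and_assoc] using hj
      · have h₁ : Der EA [add (fvar i) x =' y, x =' succ (fvar j)]
            (succ (add (fvar i) (fvar j)) =' y) :=
          (((hyp₁ (T := EA)).congr_add_right.trans (add_succ _ _)).symm).trans hyp
        simpa [inst_eq] using (show Der EA [] ((x =' succ (fvar j)) ⟹ ((add (fvar i) x =' y) ⟹ ψ))
          from intro <| intro <| ((h i j).intro.intro.lift.lift.mp hyp₁).mp h₁)
    simp only [inst_eq, bsub_bdEqual, tsub_add, tsub_last, tsub_snoc_up, tsub_level_zero]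
    exact intro <| cases (h₀.intro.lift.lift.mp hyp)
      ((H.lift.lift.mp ((zero_or_succ x).mp hyp)).mp hyp₁)

/-- What is at most `N` is one of the numerals `0, …, N`. -/
theorem le_num_cases (N : ℕ) : ∀ (x : L.Term (ℕ ⊕ Fin 0)) (ψ : L.BoundedFormula ℕ 0),
    (∀ k ≤ N, Der EA [] ((x =' num k) ⟹ ψ)) → Der EA [] (le x (num N) ⟹ ψ) := by
  induction N with
  | zero =>
    exact fun x ψ h => le_cases (h 0 le_rfl) fun i j => absurd (succ_ne_zero _) hyp
  | succ N ih =>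
    refine fun x ψ h => le_cases (h 0 (Nat.zero_le _)) fun i j => ?_
    have H := ih (fvar j) ((x =' succ (fvar j)) ⟹ ψ) fun k hk => intro <| intro <|
      (h (k + 1) (Nat.succ_le_succ hk)).lift.lift.mp (hyp.trans hyp₁.congr_succ)
    exact (H.lift.lift.mp (le_of_add (succ_inj hyp))).mp hyp₁

theorem not_le_num {a b : ℕ} (h : ¬ a ≤ b) : Der EA [] ∼(le (num a) (num b)) :=
  le_num_cases b _ _ fun _ hk => num_ne fun e => h (e ▸ hk)

theorem eval_term {t : L.Term (Empty ⊕ Fin n)} (ht : IsArith t) (v : Fin n → ℕ) :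
    Der EA Γ (tsub (fun i => num (v i)) (tembed t) =' num (t.realize (Sum.elim default v))) := by
  induction ht with
  | var a => rcases a with a | i <;> [exact a.elim; exact Der.refl _]
  | zero => simpa [num] using Der.refl (Γ := Γ) zero
  | succ t _ ih => simpa [num] using ih.congr_succ
  | add t s _ _ ih₁ ih₂ =>
    simpa using (ih₁.congr_add_left.trans ih₂.congr_add_right).trans (add_num _ _)
  | mul t s _ _ ih₁ ih₂ =>
    simpa using (ih₁.congr_mul_left.trans ih₂.congr_mul_right).trans (mul_num _ _)

theorem decides_delta0 {φ : L.BoundedFormula Empty n} (hφ : IsDelta0 φ) : ∀ v : Fin n → ℕ,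
    (φ.Realize default v → Der EA [] (bsub (bembed φ) fun i => num (v i))) ∧
      (¬ φ.Realize default v → Der EA [] ∼(bsub (bembed φ) fun i => num (v i))) := by
  induction hφ with
  | falsum => exact fun v => ⟨False.elim, fun _ => intro hyp⟩
  | eq t s ht hs =>
    refine fun v => ⟨fun h => ?_, fun h => ?_⟩
    · have h : t.realize (Sum.elim default v) = s.realize (Sum.elim default v) := h
      exact (eval_term ht v).trans (h ▸ (eval_term hs v).symm)
    · exact intro <| (num_ne h).lift.mp <| ((eval_term ht v).symm.trans hyp).trans (eval_term hs v)
  | le t s ht hs =>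
    refine fun v => ⟨fun h => ?_, fun h => ?_⟩
    · simpa using congr_le_right (eval_term hs v).symm
        (congr_le_left (eval_term ht v).symm (le_num h))
    · rw [bembed_le, bsub_le]
      exact intro <| (not_le_num h).lift.mp <|
        congr_le_right (eval_term hs v) (congr_le_left (eval_term ht v) hyp)
  | imp φ ψ _ _ ih₁ ih₂ =>
    intro v
    simp only [BoundedFormula.realize_imp, bembed_imp, bsub_imp]
    by_cases h₁ : φ.Realize default v
    · by_cases h₂ : ψ.Realize default v
      · exact ⟨fun _ => intro ((ih₂ v).1 h₂).lift, fun h => (h fun _ => h₂).elim⟩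
      · exact ⟨fun h => (h₂ (h h₁)).elim, fun _ =>
          intro <| ((ih₂ v).2 h₂).lift.mp <| hyp.mp ((ih₁ v).1 h₁).lift⟩
    · exact ⟨fun _ => intro <| absurd ((ih₁ v).2 h₁).lift hyp,
        fun h => (h fun h' => (h₁ h').elim).elim⟩
  | @ball n t φ ht _ ih =>
    intro v
    have snoc_num (k : ℕ) : (fun i => num ((Fin.snoc v k : Fin (n + 1) → ℕ) i)) =
        (Fin.snoc (fun i => num (v i)) (num k) : Fin (n + 1) → L.Term (ℕ ⊕ Fin 0)) := by
      funext i
      refine Fin.lastCases ?_ (fun i => ?_) i <;> simp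
    have ih (k : ℕ) :
        (φ.Realize default (Fin.snoc v k : Fin (n + 1) → ℕ) →
          Der EA [] (bsub (bembed φ) (Fin.snoc (fun i => num (v i)) (num k)))) ∧
        (¬ φ.Realize default (Fin.snoc v k : Fin (n + 1) → ℕ) →
          Der EA [] ∼(bsub (bembed φ) (Fin.snoc (fun i => num (v i)) (num k)))) :=
      snoc_num k ▸ ih (Fin.snoc v k)
    have bound (x : L.Term (ℕ ⊕ Fin 0)) :
        tsub (Fin.snoc (fun i => num (v i)) x : Fin (n + 1) → L.Term (ℕ ⊕ Fin 0))
          (tembed (up t)) = tsub (fun i => num (v i)) (tembed t) := by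
      rw [tembed_up, tsub_snoc_up]
    rw [realize_ball]
    refine ⟨fun h => gen_bsub (φ := bembed (le last (up t) ⟹ φ)) 0
      (by rw [freeVarFinset_bembed]; simp) (by simp) ?_, fun h => ?_⟩
    · simp only [bembed_imp, bembed_le, bsub_imp, bsub_le, bound, tembed_last, tsub_last]
      have H := le_num_cases (t.realize (Sum.elim default v)) (fvar 0)
        (bsub (bembed φ) (Fin.snoc (fun i => num (v i)) (fvar 0))) fun k hk =>
        intro <| leib_bsub hyp.symm ((ih k).1 (h k hk)).lift
      exact intro <| H.lift.mp <| congr_le_right (eval_term ht v) hyp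
    · push Not at h
      obtain ⟨k, hk, h⟩ := h
      have H : Der EA [bsub (bembed (ball t φ)) fun i => num (v i)] _ :=
        spec_bsub (φ := bembed (le last (up t) ⟹ φ)) hyp (num k)
      simp only [bembed_imp, bembed_le, bsub_imp, bsub_le, bound, tembed_last, tsub_last] at H
      exact intro <| ((ih k).2 h).lift.mp <| H.mp <|
        congr_le_right (eval_term ht v).symm (le_num hk)

end EA

/-! ### The proof predicate is a bounded formula -/

section Bounded

variable {m n : ℕ}

theorem IsArith.up {t : L.Term (Empty ⊕ Fin n)} (ht : IsArith t) :
    IsArith (ConsistencySchema.up t) := by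
  induction ht with
  | var a => rcases a with a | i <;> exact .var _
  | zero => rw [up_zero]; exact .zero
  | succ t _ ih => rw [up_succ]; exact .succ _ ih
  | add t s _ _ ih₁ ih₂ => rw [up_add]; exact .add _ _ ih₁ ih₂
  | mul t s _ _ ih₁ ih₂ => rw [up_mul]; exact .mul _ _ ih₁ ih₂

theorem IsArith.bd (i : Fin n) : IsArith (ConsistencySchema.bd i : L.Term (Empty ⊕ Fin n)) :=
  .var _

theorem IsArith.num : ∀ k : ℕ, IsArith (ConsistencySchema.num k : L.Term (Empty ⊕ Fin n))
  | 0 => .zero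
  | k + 1 => .succ _ (num k)

namespace IsDelta0

variable {φ ψ : L.BoundedFormula Empty n}

theorem not (h : IsDelta0 φ) : IsDelta0 ∼φ := .imp _ _ h .falsum

theorem inf (h : IsDelta0 φ) (h' : IsDelta0 ψ) : IsDelta0 (φ ⊓ ψ) := not (.imp _ _ h h'.not)

theorem sup (h : IsDelta0 φ) (h' : IsDelta0 ψ) : IsDelta0 (φ ⊔ ψ) := .imp _ _ h.not h'

theorem top : IsDelta0 (⊤ : L.BoundedFormula Empty n) := not .falsum

theorem bex {φ : L.BoundedFormula Empty (n + 1)} {t : L.Term (Empty ⊕ Fin n)} (ht : IsArith t)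
    (h : IsDelta0 φ) : IsDelta0 (ConsistencySchema.bex t φ) := not (.ball _ _ ht h.not)

theorem conj {l : List (L.BoundedFormula Empty n)} (h : ∀ φ ∈ l, IsDelta0 φ) :
    IsDelta0 (ConsistencySchema.conj l) := by
  induction l with
  | nil => exact top
  | cons φ l ih =>
    exact (h φ (by simp)).inf (ih fun ψ hψ => h ψ (by simp [hψ]))

theorem disj {l : List (L.BoundedFormula Empty n)} (h : ∀ φ ∈ l, IsDelta0 φ) :
    IsDelta0 (ConsistencySchema.disj l) := by
  induction l with
  | nil => exact .falsum
  | cons φ l ih =>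
    exact (h φ (by simp)).sup (ih fun ψ hψ => h ψ (by simp [hψ]))

theorem pairF {u v y : L.Term (Empty ⊕ Fin n)} (hu : IsArith u) (hv : IsArith v)
    (hy : IsArith y) : IsDelta0 (pairF u v y) :=
  sup (inf (.le _ _ hu.succ hv) (.eq _ _ hy (.add _ _ (.mul _ _ hv hv) hu)))
    (inf (.le _ _ hv hu) (.eq _ _ hy (.add _ _ (.add _ _ (.mul _ _ hu hu) hu) hv)))

theorem betaF {s j y : L.Term (Empty ⊕ Fin n)} (hs : IsArith s) (hj : IsArith j)
    (hy : IsArith y) : IsDelta0 (betaF s j y) :=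
  have hm : IsArith (ConsistencySchema.succ (mul (ConsistencySchema.succ (up (up j))) last)) :=
    .succ _ (.mul _ _ (.succ _ hj.up.up) (.bd _))
  bex hs <| bex hs.up <| inf (inf (pairF (.bd _) (.bd _) hs.up.up) (.le _ _ (.succ _ hy.up.up) hm))
    (bex (.bd _) (.eq _ _ (IsArith.bd _).up (.add _ _ (.mul _ _ (.bd _) hm.up) hy.up.up.up)))

theorem patF (q : Pat) : ∀ {n : ℕ} {v : Fin 6 → L.Term (Empty ⊕ Fin n)}
    {y : L.Term (Empty ⊕ Fin n)}, (∀ i, IsArith (v i)) → IsArith y → IsDelta0 (patF q v y) := by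
  induction q with
  | var i => exact fun hv hy => .eq _ _ hy (hv i)
  | lit k => exact fun _ hy => .eq _ _ hy (.num k)
  | suc a ih =>
    exact fun hv hy => bex hy <| inf (.eq _ _ hy.up (.succ _ (.bd _)))
      (ih (fun i => (hv i).up) (.bd _))
  | pair a b ih₁ ih₂ =>
    exact fun hv hy => bex hy <| bex hy.up <| inf
      (inf (pairF (.bd _) (.bd _) hy.up.up) (ih₁ (fun i => (hv i).up.up) (.bd _)))
      (ih₂ (fun i => (hv i).up.up) (.bd _))

theorem premF (q : Pat) : IsDelta0 (premF q) :=
  bex (.bd _) <| inf (not (.eq _ _ (.bd _) (.bd _))) <| bex (.bd _) <|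
    inf (betaF (.bd _) (.bd _) (.bd _)) (patF q (fun i => by fin_cases i <;> exact .bd _) (.bd _))

theorem ruleF (r : Rule) : IsDelta0 (ruleF r) := by
  refine inf (patF r.concl (fun i => by fin_cases i <;> exact .bd _) (.bd _)) (conj fun φ hφ => ?_)
  obtain ⟨q, -, rfl⟩ := List.mem_map.1 hφ
  exact premF q

theorem proofF (e : Nat.Partrec.Code) : IsDelta0 (proofF e) := by
  refine bex (.bd _) <| bex (.bd _) <| inf (inf (pairF (.bd _) (.bd _) (.bd _)) ?_) ?_
  · exact bex (.bd _) <| inf (.eq _ _ (.succ _ (.bd _)) (.bd _)) <| bex (.bd _) <|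
      inf (betaF (.bd _) (.bd _) (.bd _)) (patF _ (fun _ => .bd _) (.bd _))
  · refine ball _ _ (.bd _) <| sup (.eq _ _ (.bd _) (.bd _)) <| bex (.bd _) <|
      inf (betaF (.bd _) (.bd _) (.bd _)) <| bex (.bd _) <| bex (.bd _) <| bex (.bd _) <|
      bex (.bd _) <| bex (.bd _) <| bex (.bd _) <| disj fun φ hφ => ?_
    obtain ⟨r, -, rfl⟩ := List.mem_map.1 hφ
    exact ruleF r

end IsDelta0

end Bounded

/-! ### The proof predicate in the standard model -/

section StandardModel

variable {n : ℕ} {v : Fin n → ℕ}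

theorem realize_pairF (t s y : L.Term (Empty ⊕ Fin n)) :
    (pairF t s y).Realize default v ↔
      y.realize (Sum.elim default v) =
        Nat.pair (t.realize (Sum.elim default v)) (s.realize (Sum.elim default v)) := by
  simp only [pairF, BoundedFormula.realize_sup, BoundedFormula.realize_inf, realize_le,
    BoundedFormula.realize_bdEqual, realize_succ, realize_add, realize_mul, Nat.pair]
  split_ifs <;> omega

theorem realize_betaF (s j y : L.Term (Empty ⊕ Fin n)) :
    (betaF s j y).Realize default v ↔
      Nat.beta (s.realize (Sum.elim default v)) (j.realize (Sum.elim default v)) =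
        y.realize (Sum.elim default v) := by
  simp only [betaF, realize_bex, BoundedFormula.realize_inf, realize_le, realize_pairF,
    BoundedFormula.realize_bdEqual, realize_succ, realize_add, realize_mul, realize_up,
    realize_last, realize_bd, Fin.snoc_castSucc, Fin.snoc_last]
  constructor
  · rintro ⟨a, -, b, -, ⟨h, hlt⟩, c, -, hc⟩
    rw [h, Nat.beta, Nat.unpair_pair, hc, Nat.mul_add_mod_self_right, Nat.mod_eq_of_lt hlt]
  · intro h
    refine ⟨_, Nat.unpair_left_le _, _, Nat.unpair_right_le _,
      ⟨(Nat.pair_unpair _).symm, ?_⟩, _, Nat.div_le_self _ ((j.realize (Sum.elim default v) + 1) *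
        (s.realize (Sum.elim default v)).unpair.2 + 1), ?_⟩
    · rw [← h]
      exact Nat.mod_lt _ (Nat.succ_pos _)
    · rw [← h]
      exact (Nat.div_add_mod' _ _).symm

theorem beta_le (s i : ℕ) : Nat.beta s i ≤ s := (Nat.mod_le _ _).trans (Nat.unpair_left_le s)

theorem realize_patF (q : Pat) : ∀ {n : ℕ} {v : Fin n → ℕ} (t : Fin 6 → L.Term (Empty ⊕ Fin n))
    (y : L.Term (Empty ⊕ Fin n)),
    (patF q t y).Realize default v ↔
      y.realize (Sum.elim default v) = q.eval fun i => (t i).realize (Sum.elim default v) := by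
  induction q with
  | var i => exact fun t y => Iff.rfl
  | lit k => exact fun t y => by simp [patF, Pat.eval]
  | suc a ih =>
    intro n v t y
    simp only [patF, realize_bex, BoundedFormula.realize_inf, BoundedFormula.realize_bdEqual,
      realize_up, realize_succ, realize_last, ih, Pat.eval]
    exact ⟨fun ⟨x, _, h, h'⟩ => h' ▸ h, fun h => ⟨_, by omega, h, rfl⟩⟩
  | pair a b ih₁ ih₂ =>
    intro n v t y
    simp only [patF, realize_bex, BoundedFormula.realize_inf, realize_pairF, realize_up,
      realize_last, realize_bd, Fin.snoc_castSucc, Fin.snoc_last, ih₁, ih₂, Pat.eval]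
    constructor
    · rintro ⟨x, -, z, -, ⟨h, rfl⟩, rfl⟩
      exact h
    · exact fun h => ⟨_, h ▸ Nat.left_le_pair _ _, _, h ▸ Nat.right_le_pair _ _, ⟨h, rfl⟩, rfl⟩

theorem realize_premF (q : Pat) (v : Fin 12 → ℕ) :
    (premF q).Realize default v ↔
      ∃ j < v 4, Nat.beta (v 3) j = q.eval ![v 6, v 7, v 8, v 9, v 10, v 11] := by
  have hv (x y : ℕ) : (fun i => Term.realize (Sum.elim (default : Empty → ℕ)
      (Fin.snoc (Fin.snoc v x : Fin 13 → ℕ) y : Fin 14 → ℕ))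
      ((![bd 6, bd 7, bd 8, bd 9, bd 10, bd 11] : Fin 6 → L.Term (Empty ⊕ Fin 14)) i)) =
      ![v 6, v 7, v 8, v 9, v 10, v 11] := by
    funext i
    fin_cases i <;> rfl
  simp only [premF, realize_bex, BoundedFormula.realize_inf, BoundedFormula.realize_not,
    BoundedFormula.realize_bdEqual, realize_betaF, realize_patF, realize_bd, hv]
  change (∃ x ≤ v 4, ¬ x = v 4 ∧ ∃ y ≤ v 3, Nat.beta (v 3) x = y ∧ y = q.eval _) ↔ _
  constructor
  · rintro ⟨x, hx, hne, y, -, rfl, h⟩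
    exact ⟨x, by omega, h⟩
  · rintro ⟨x, hx, h⟩
    exact ⟨x, hx.le, hx.ne, _, beta_le _ _, rfl, h⟩

theorem realize_ruleF (r : Rule) (v : Fin 12 → ℕ) :
    (ruleF r).Realize default v ↔
      v 5 = r.concl.eval ![v 6, v 7, v 8, v 9, v 10, v 11] ∧
      ∀ q ∈ r.prem, ∃ j < v 4, Nat.beta (v 3) j = q.eval ![v 6, v 7, v 8, v 9, v 10, v 11] := by
  have hv : (fun i => Term.realize (Sum.elim (default : Empty → ℕ) v)
      ((![bd 6, bd 7, bd 8, bd 9, bd 10, bd 11] : Fin 6 → L.Term (Empty ⊕ Fin 12)) i)) =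
      ![v 6, v 7, v 8, v 9, v 10, v 11] := by
    funext i
    fin_cases i <;> rfl
  simp only [ruleF, conj, BoundedFormula.realize_inf, BoundedFormula.realize_foldr_inf,
    List.forall_mem_map, realize_patF, realize_premF, realize_bd, hv]

/-- Values of variables that exceed the number described by a pattern do not matter. -/
theorem Pat.eval_truncate {q : Pat} {v : Fin 6 → ℕ} {N : ℕ} (h : q.eval v ≤ N) :
    q.eval (fun i => if v i ≤ N then v i else 0) = q.eval v := by
  induction q with
  | var i => exact if_pos h
  | lit k => rfl
  | suc a ih => exact congrArg Nat.succ (ih (Nat.le_of_succ_le h))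
  | pair a b ih₁ ih₂ =>
    exact congrArg₂ Nat.pair (ih₁ ((Nat.left_le_pair _ _).trans h))
      (ih₂ ((Nat.right_le_pair _ _).trans h))

theorem realize_proofF (e : Nat.Partrec.Code) (p x : ℕ) :
    (proofF e).Realize default ![p, x] ↔ IsProof e p x := by
  simp only [proofF, disj, realize_bex, realize_ball, BoundedFormula.realize_inf,
    BoundedFormula.realize_sup, BoundedFormula.realize_foldr_sup, List.mem_map, exists_exists_and_eq_and,
    BoundedFormula.realize_bdEqual, realize_betaF, realize_pairF, realize_patF, realize_ruleF,
    realize_bd, realize_succ]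
  change (∃ len ≤ p, ∃ s ≤ p, (p = Nat.pair len s ∧
    ∃ i ≤ len, i + 1 = len ∧ ∃ y ≤ s, Nat.beta s i = y ∧ y = Nat.pair 7 x) ∧
    ∀ i ≤ len, i = len ∨ ∃ y ≤ s, Nat.beta s i = y ∧
      ∃ a ≤ p, ∃ b ≤ p, ∃ c ≤ p, ∃ d ≤ p, ∃ f ≤ p, ∃ g ≤ p, ∃ r ∈ rules e,
        y = r.concl.eval ![a, b, c, d, f, g] ∧
        ∀ q ∈ r.prem, ∃ j < i, Nat.beta s j = q.eval ![a, b, c, d, f, g]) ↔ _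
  constructor
  · rintro ⟨len, -, s, -, ⟨rfl, i, -, hi, y, -, rfl, hy⟩, H⟩
    simp only [IsProof, Nat.unpair_pair]
    refine ⟨⟨i, hi, hy⟩, fun j hj => ?_⟩
    obtain h | ⟨y, -, rfl, a, -, b, -, c, -, d, -, f, -, g, -, r, hr, h, h'⟩ := H j hj.le
    · exact absurd h hj.ne
    · exact ⟨r, hr, _, h, h'⟩
  · rintro ⟨⟨i, hi, hy⟩, H⟩
    refine ⟨_, Nat.unpair_left_le p, _, Nat.unpair_right_le p,
      ⟨(Nat.pair_unpair p).symm, i, by omega, hi, _, beta_le _ _, rfl, hy⟩, fun j hj => ?_⟩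
    obtain h | h := hj.eq_or_lt
    · exact .inl h
    obtain ⟨r, hr, v, h₁, h₂⟩ := H j h
    have hv (i) : (if v i ≤ p then v i else 0) ≤ p := by split_ifs <;> omega
    have hw : ![if v 0 ≤ p then v 0 else 0, if v 1 ≤ p then v 1 else 0,
        if v 2 ≤ p then v 2 else 0, if v 3 ≤ p then v 3 else 0, if v 4 ≤ p then v 4 else 0,
        if v 5 ≤ p then v 5 else 0] = fun i => if v i ≤ p then v i else 0 := by
      funext i
      fin_cases i <;> rfl
    have hs : ∀ k, Nat.beta p.unpair.2 k ≤ p := fun k =>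
      (beta_le _ _).trans (Nat.unpair_right_le p)
    refine .inr ⟨_, beta_le _ _, rfl, _, hv 0, _, hv 1, _, hv 2, _, hv 3, _, hv 4, _, hv 5,
      r, hr, ?_⟩
    rw [hw]
    refine ⟨h₁.trans (Pat.eval_truncate (h₁ ▸ hs _)).symm, fun q hq => ?_⟩
    obtain ⟨k, hk, h⟩ := h₂ q hq
    exact ⟨k, hk, h.trans (Pat.eval_truncate (h ▸ hs _)).symm⟩

end StandardModel

/-! ### Computability of bounded formulas -/

section Computability

theorem IsArith.primrec {n : ℕ} {t : L.Term (Empty ⊕ Fin n)} (ht : IsArith t) {α : Type}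
    [Primcodable α] {f : α → Fin n → ℕ} (hf : ∀ i, Primrec fun a => f a i) :
    Primrec fun a => t.realize (Sum.elim default (f a)) := by
  induction ht with
  | var a => rcases a with a | i <;> [exact a.elim; exact hf i]
  | zero => exact Primrec.const 0
  | succ t _ ih => exact Primrec.succ.comp ih
  | add t s _ _ ih₁ ih₂ => exact Primrec.nat_add.comp ih₁ ih₂
  | mul t s _ _ ih₁ ih₂ => exact Primrec.nat_mul.comp ih₁ ih₂

/-- The relation defined by a bounded formula is primitive recursive. -/
theorem IsDelta0.primrecPred {n : ℕ} {φ : L.BoundedFormula Empty n} (hφ : IsDelta0 φ) :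
    ∀ {α : Type} [Primcodable α] {f : α → Fin n → ℕ}, (∀ i, Primrec fun a => f a i) →
      PrimrecPred fun a => φ.Realize default (f a) := by
  induction hφ with
  | falsum =>
    exact fun _ => (PrimrecPred.not (Primrec.eq.comp (.const 0) (.const 0))).of_eq
      fun a => by simp
  | eq t s ht hs => exact fun hf => Primrec.eq.comp (ht.primrec hf) (hs.primrec hf)
  | le t s ht hs => exact fun hf => Primrec.nat_le.comp (ht.primrec hf) (hs.primrec hf)
  | imp φ ψ _ _ ih₁ ih₂ =>
    exact fun hf => ((ih₁ hf).not.or (ih₂ hf)).of_eq fun a => by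
      simp only [BoundedFormula.realize_imp]; tauto
  | @ball n t φ ht _ ih =>
    intro α _ f hf
    have h : PrimrecRel fun (x : ℕ) (a : α) => φ.Realize default (Fin.snoc (f a) x) := by
      refine ih (α := ℕ × α) (f := fun p => Fin.snoc (f p.2) p.1) fun i => ?_
      refine Fin.lastCases ?_ (fun i => ?_) i
      · simpa using Primrec.fst
      · simpa using (hf i).comp Primrec.snd
    refine (h.forall_mem_list.comp
      (Primrec.list_range.comp (Primrec.succ.comp (ht.primrec hf))) .id).of_eq fun a => ?_
    simp

end Computability

/-! ### Expressions as trees -/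

/-- Trees whose leaves are free variables, bound variables and numbers. -/
inductive Tree
  | free (i : ℕ)
  | bound (i : ℕ)
  | atom (k : ℕ)
  | node (a b : Tree)

namespace Tree

/-- Code of a tree. -/
def code : Tree → ℕ
  | free i => gFree i
  | bound i => gBound i
  | atom k => gAtom k
  | node a b => gNode a.code b.code

/-- The free variable `x` does not occur. -/
def Fresh (x : ℕ) : Tree → Prop
  | free i => x ≠ i
  | bound _ => True
  | atom _ => True
  | node a b => a.Fresh x ∧ b.Fresh x

/-- Substitution for the bound variable of index `0`. -/
def inst : Tree → Tree → Tree
  | free i, _ => free i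
  | bound 0, t => t
  | bound (i + 1), _ => bound i
  | atom k, _ => atom k
  | node a b, t => node (a.inst t) (b.inst t)

theorem code_injective : Function.Injective code := by
  intro s t
  induction s generalizing t with
  | free i => cases t <;> simp [code, gFree, gBound, gAtom, gNode]
  | bound i => cases t <;> simp [code, gFree, gBound, gAtom, gNode]
  | atom i => cases t <;> simp [code, gFree, gBound, gAtom, gNode]
  | node a b ha hb =>
    cases t with
    | node c d =>
      simp only [code, gNode, Nat.pair_eq_pair, true_and, node.injEq]
      exact fun h => ⟨ha h.1, hb h.2⟩
    | _ => simp [code, gFree, gBound, gAtom, gNode]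

theorem code_eq_gFree {t : Tree} {i : ℕ} : t.code = gFree i ↔ t = free i :=
  code_injective.eq_iff (b := free i)

theorem code_eq_gBound {t : Tree} {i : ℕ} : t.code = gBound i ↔ t = bound i :=
  code_injective.eq_iff (b := bound i)

theorem code_eq_gAtom {t : Tree} {i : ℕ} : t.code = gAtom i ↔ t = atom i :=
  code_injective.eq_iff (b := atom i)

theorem code_eq_gNode {t : Tree} {a b : ℕ} :
    t.code = gNode a b ↔ ∃ s u, t = node s u ∧ s.code = a ∧ u.code = b := by
  cases t <;> simp [code, gFree, gBound, gAtom, gNode]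

/-- The tree of a list of trees. -/
def ofList : List Tree → Tree
  | [] => atom 0
  | a :: l => node a (ofList l)

theorem ofList_injective : Function.Injective ofList
  | [], [], _ => rfl
  | [], _ :: _, h => by simp [ofList] at h
  | _ :: _, [], h => by simp [ofList] at h
  | a :: l, b :: l', h => by
    simp only [ofList, node.injEq] at h
    rw [h.1, ofList_injective h.2]

theorem code_ofList (l : List Tree) : (ofList l).code = gList (l.map code) := by
  induction l with
  | nil => rfl
  | cons a l ih => simp [ofList, code, gList, ih]

theorem inst_ofList (t : Tree) (l : List Tree) :
    (ofList l).inst t = ofList (l.map fun a => a.inst t) := by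
  induction l with
  | nil => rfl
  | cons a l ih => simp [ofList, inst, ih]

theorem fresh_ofList {x : ℕ} {l : List Tree} : (ofList l).Fresh x ↔ ∀ a ∈ l, a.Fresh x := by
  induction l with
  | nil => simp [ofList, Fresh]
  | cons a l ih => simp [ofList, Fresh, ih]

/-- The tree of a term. -/
def ofTerm {n : ℕ} : L.Term (ℕ ⊕ Fin n) → Tree
  | .var (Sum.inl i) => free i
  | .var (Sum.inr i) => bound i
  | .func (l := l) f ts =>
      node (node (atom l) (atom (f : ℕ))) (ofList (List.ofFn fun i => ofTerm (ts i)))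

/-- The tree of a formula. -/
def ofForm : ∀ {n : ℕ}, L.BoundedFormula ℕ n → Tree
  | _, .falsum => node (atom 0) (atom 0)
  | _, .equal t s => node (atom 1) (node (ofTerm t) (ofTerm s))
  | _, .rel (l := l) R ts =>
      node (atom 2)
        (node (node (atom l) (atom (R : ℕ))) (ofList (List.ofFn fun i => ofTerm (ts i))))
  | _, .imp φ ψ => node (atom 3) (node (ofForm φ) (ofForm ψ))
  | _, .all φ => node (atom 4) (ofForm φ)

variable {m n : ℕ}

theorem code_ofTerm (t : L.Term (ℕ ⊕ Fin n)) : (ofTerm t).code = gTerm t := by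
  induction t with
  | var a => rcases a with a | i <;> rfl
  | func f ts ih =>
    simp only [ofTerm, gTerm, code, code_ofList, List.map_ofFn, Function.comp_def, ih]

theorem code_ofForm (φ : L.BoundedFormula ℕ n) : (ofForm φ).code = gForm φ := by
  induction φ with
  | falsum => rfl
  | equal t s => simp only [ofForm, gForm, code, code_ofTerm]
  | rel R ts =>
    simp only [ofForm, gForm, code, code_ofList, List.map_ofFn, Function.comp_def, code_ofTerm]
  | imp φ ψ h₁ h₂ => simp only [ofForm, gForm, code, h₁, h₂]
  | all φ ih => simp only [ofForm, gForm, code, ih]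

theorem ofTerm_injective : Function.Injective (ofTerm (n := n)) := by
  intro s t h
  induction s generalizing t with
  | var a =>
    rcases a with a | i <;> rcases t with (b | j) | ⟨f, ts⟩ <;>
      simp_all [ofTerm, Fin.val_inj]
  | func f ts ih =>
    rcases t with (b | j) | ⟨f', ts'⟩
    · simp [ofTerm] at h
    · simp [ofTerm] at h
    · simp only [ofTerm, node.injEq, atom.injEq] at h
      obtain ⟨⟨rfl, hf⟩, h⟩ := h
      obtain rfl : f = f' := hf
      have h := List.ofFn_injective (ofList_injective h)
      exact congrArg _ (funext fun i => ih i (congrFun h i))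

theorem ofForm_injective : Function.Injective (ofForm (n := n)) := by
  intro φ ψ h
  induction φ with
  | falsum => cases ψ <;> simp_all [ofForm]
  | equal t s =>
    cases ψ <;> simp only [ofForm, node.injEq, atom.injEq] at h
    all_goals try omega
    rw [ofTerm_injective h.2.1, ofTerm_injective h.2.2]
  | rel R ts =>
    cases ψ <;> simp only [ofForm, node.injEq, atom.injEq] at h
    all_goals try omega
    obtain ⟨-, ⟨rfl, hR⟩, h⟩ := h
    have h := List.ofFn_injective (ofList_injective h)
    exact congr (congrArg _ hR) (funext fun i => ofTerm_injective (congrFun h i))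
  | imp φ ψ h₁ h₂ =>
    cases ψ <;> simp only [ofForm, node.injEq, atom.injEq] at h
    all_goals try omega
    rw [h₁ h.2.1, h₂ h.2.2]
  | all φ ih =>
    cases ψ <;> simp only [ofForm, node.injEq, atom.injEq] at h
    all_goals try omega
    rw [ih h.2]

theorem ofTerm_up (t : L.Term (ℕ ⊕ Fin n)) : ofTerm (up t) = ofTerm t := by
  induction t with
  | var a => rcases a with a | i <;> rfl
  | func f ts ih =>
    simp only [up, Term.relabel, ofTerm] at ih ⊢
    simp only [ih]

theorem ofTerm_tsub {T : Tree} {f : Fin m → L.Term (ℕ ⊕ Fin n)}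
    (hf : ∀ i : Fin m, ofTerm (f i) = (bound i).inst T) (t : L.Term (ℕ ⊕ Fin m)) :
    ofTerm (tsub f t) = (ofTerm t).inst T := by
  induction t with
  | var a =>
    rcases a with a | i
    · rfl
    · exact hf i
  | func g ts ih =>
    simp only [tsub, Term.subst, ofTerm, inst, inst_ofList, List.map_ofFn, Function.comp_def]
      at ih ⊢
    simp only [ih]

theorem ofForm_bsub {T : Tree} (φ : L.BoundedFormula ℕ m) :
    ∀ {n : ℕ} {f : Fin m → L.Term (ℕ ⊕ Fin n)}, m = n + 1 →
      (∀ i : Fin m, ofTerm (f i) = (bound i).inst T) →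
      ofForm (bsub φ f) = (ofForm φ).inst T := by
  induction φ with
  | falsum => intros; rfl
  | equal t s =>
    intro n f _ hf
    exact congrArg _ (congrArg₂ _ (ofTerm_tsub hf t) (ofTerm_tsub hf s))
  | rel R ts =>
    intro n f _ hf
    simp only [ofForm, bsub, inst, inst_ofList, List.map_ofFn, Function.comp_def]
    congr! 4
    exact funext fun i => ofTerm_tsub hf (ts i)
  | imp φ ψ h₁ h₂ =>
    intro n f h hf
    exact congrArg _ (congrArg₂ _ (h₁ h hf) (h₂ h hf))
  | @all m φ ih =>
    intro n f h hf
    refine congrArg _ (ih (by omega) fun i => ?_)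
    refine Fin.lastCases ?_ (fun i => ?_) i
    · subst h
      simp [last, bd, ofTerm, inst]
    · simpa [ofTerm_up] using hf i

theorem ofForm_inst (φ : L.BoundedFormula ℕ 1) (t : L.Term (ℕ ⊕ Fin 0)) :
    ofForm (ConsistencySchema.inst φ t) = (ofForm φ).inst (ofTerm t) :=
  ofForm_bsub φ rfl fun i => by fin_cases i; rfl

theorem notMem_of_fresh_ofTerm {x : ℕ} {t : L.Term (ℕ ⊕ Fin n)} (h : (ofTerm t).Fresh x) :
    x ∉ t.varFinsetLeft := by
  induction t with
  | var a => rcases a with a | i <;> simp_all [ofTerm, Fresh, Term.varFinsetLeft]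
  | func f ts ih =>
    simp only [ofTerm, Fresh, fresh_ofList, List.forall_mem_ofFn_iff] at h
    simp only [Term.varFinsetLeft, Finset.mem_biUnion, Finset.mem_univ, true_and, not_exists]
    exact fun i => ih i (h.2 i)

theorem notMem_of_fresh_ofForm {x : ℕ} {φ : L.BoundedFormula ℕ n} (h : (ofForm φ).Fresh x) :
    x ∉ φ.freeVarFinset := by
  induction φ with
  | falsum => simp [BoundedFormula.freeVarFinset]
  | equal t s =>
    simp only [BoundedFormula.freeVarFinset, Finset.mem_union, not_or]
    exact ⟨notMem_of_fresh_ofTerm h.2.1, notMem_of_fresh_ofTerm h.2.2⟩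
  | rel R ts =>
    simp only [ofForm, Fresh, fresh_ofList, List.forall_mem_ofFn_iff] at h
    simp only [BoundedFormula.freeVarFinset, Finset.mem_biUnion, Finset.mem_univ, true_and,
      not_exists]
    exact fun i => notMem_of_fresh_ofTerm (h.2.2 i)
  | imp φ ψ h₁ h₂ =>
    simp only [BoundedFormula.freeVarFinset, Finset.mem_union, not_or]
    exact ⟨h₁ h.2.1, h₂ h.2.2⟩
  | all φ ih => exact ih h.2

end Tree

theorem gForm_injective {n : ℕ} : Function.Injective (gForm (n := n)) := fun φ ψ h =>
  Tree.ofForm_injective <| Tree.code_injective <| by rw [Tree.code_ofForm, Tree.code_ofForm, h]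

theorem gForm_eq_imp {n : ℕ} {φ : L.BoundedFormula ℕ n} {a b : ℕ}
    (h : gForm φ = gNode (gAtom 3) (gNode a b)) :
    ∃ ψ χ, φ = (ψ ⟹ χ) ∧ gForm ψ = a ∧ gForm χ = b := by
  cases φ <;> simp [gForm, gNode, gAtom] at h
  exact ⟨_, _, rfl, h⟩

/-! ### Soundness of coded derivations -/

/-- `t` codes a term whose bound variables have index `< n`. -/
def IsTermCode (n t : ℕ) : Prop := ∃ τ : L.Term (ℕ ⊕ Fin n), gTerm τ = t

/-- `ts` codes a list of `k` terms whose bound variables have index `< n`. -/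
def IsTermsCode (n k ts : ℕ) : Prop :=
  ∃ τ : Fin k → L.Term (ℕ ⊕ Fin n), gList (List.ofFn fun i => gTerm (τ i)) = ts

/-- `a` codes a formula whose not yet quantified bound variables have index `< n`. -/
def IsFormCode (n a : ℕ) : Prop := ∃ φ : L.BoundedFormula ℕ n, gForm φ = a

/-- The line `y` of a coded derivation is correct. -/
def Valid (T : L.Theory) (y : ℕ) : Prop :=
  let z := y.unpair.2
  let z₁ := z.unpair.1
  let z₂ := z.unpair.2
  match y.unpair.1 with
  | 0 => z₁ ≠ z₂
  | 1 => IsTermCode z₁ z₂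
  | 2 => IsTermsCode z₁ z₂.unpair.1 z₂.unpair.2
  | 3 => IsFormCode z₁ z₂
  | 4 => ∀ A : Tree, A.code = z₂ → A.Fresh z₁
  | 5 => ∀ t A : Tree, t.code = z₁ → A.code = z₂.unpair.1 → (A.inst t).code = z₂.unpair.2
  | 6 => ∀ p : Nat.Partrec.Code, gProg p = z₁ → z₂.unpair.2 ∈ p.eval z₂.unpair.1
  | _ => ∃ φ : L.BoundedFormula ℕ 0, gForm φ = z ∧ Derivable T φ

section Valid

open Pat

variable {T : L.Theory} {v : Fin 6 → ℕ} {a b c d : Pat}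

theorem valid_jNe : Valid T ((jNe a b).eval v) ↔ a.eval v ≠ b.eval v := by
  simp [Valid, jNe, Pat.eval]

theorem valid_jTerm : Valid T ((jTerm a b).eval v) ↔ IsTermCode (a.eval v) (b.eval v) := by
  simp [Valid, jTerm, Pat.eval]

theorem valid_jTerms :
    Valid T ((jTerms a b c).eval v) ↔ IsTermsCode (a.eval v) (b.eval v) (c.eval v) := by
  simp [Valid, jTerms, Pat.eval]

theorem valid_jForm : Valid T ((jForm a b).eval v) ↔ IsFormCode (a.eval v) (b.eval v) := by
  simp [Valid, jForm, Pat.eval]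

theorem valid_jFresh : Valid T ((jFresh a b).eval v) ↔
    ∀ A : Tree, A.code = b.eval v → A.Fresh (a.eval v) := by
  simp [Valid, jFresh, Pat.eval]

theorem valid_jInst : Valid T ((jInst a b c).eval v) ↔
    ∀ t A : Tree, t.code = a.eval v → A.code = b.eval v → (A.inst t).code = c.eval v := by
  simp [Valid, jInst, Pat.eval]

theorem valid_jEval : Valid T ((jEval a b c).eval v) ↔
    ∀ p : Nat.Partrec.Code, gProg p = a.eval v → c.eval v ∈ p.eval (b.eval v) := by
  simp [Valid, jEval, Pat.eval]

theorem valid_jDer : Valid T ((jDer a).eval v) ↔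
    ∃ φ : L.BoundedFormula ℕ 0, gForm φ = a.eval v ∧ Derivable T φ := by
  simp [Valid, jDer, Pat.eval]

theorem eval_free : (free a).eval v = gFree (a.eval v) := rfl

theorem eval_bound : (bound a).eval v = gBound (a.eval v) := rfl

theorem eval_atom : (atom a).eval v = gAtom (a.eval v) := rfl

theorem eval_node : (node a b).eval v = gNode (a.eval v) (b.eval v) := rfl

/-- A rule is sound if it leads from correct lines to correct lines. -/
def Rule.Sound (T : L.Theory) (r : Rule) : Prop :=
  ∀ v, (∀ q ∈ r.prem, Valid T (q.eval v)) → Valid T (r.concl.eval v)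

theorem IsTermCode.succ {n t : ℕ} : IsTermCode n t → IsTermCode (n + 1) t
  | ⟨τ, h⟩ => ⟨up τ, by rw [← h, ← Tree.code_ofTerm, Tree.ofTerm_up, Tree.code_ofTerm]⟩

theorem IsTermsCode.cons {n k t ts : ℕ} :
    IsTermCode n t → IsTermsCode n k ts → IsTermsCode n (k + 1) (gNode t ts)
  | ⟨τ, h⟩, ⟨τs, h'⟩ => ⟨Fin.cons τ τs, by simp [List.ofFn_succ, gList, h, h']⟩

theorem sound_sideRules : ∀ r ∈ sideRules, r.Sound T := by
  simp only [sideRules, List.forall_mem_cons, Rule.Sound, List.not_mem_nil, false_imp_iff,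
    implies_true, and_true, forall_true_left, valid_jNe, valid_jTerm, valid_jTerms, valid_jForm,
    valid_jFresh, valid_jInst, func, falsum, equal, rel, imp, all, eval_free, eval_bound,
    eval_atom, eval_node, and_imp]
  simp only [Pat.eval, Tree.code_eq_gFree, Tree.code_eq_gBound, Tree.code_eq_gAtom,
    Tree.code_eq_gNode]
  refine ⟨?_, ?_, ?_, ?_, ?_, ?_, ?_, ?_, ?_, ?_, ?_, ?_, ?_, ?_, ?_, ?_, ?_, ?_, ?_, ?_, ?_, ?_,
    ?_⟩
  all_goals intro v
  · omega
  · omega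
  · omega
  · exact ⟨.var (Sum.inl (v 1)), rfl⟩
  · exact ⟨bd (Fin.last (v 0)), rfl⟩
  · exact IsTermCode.succ
  · exact fun ⟨τ, h⟩ => ⟨.func (l := v 1) (v 3) τ, by rw [gTerm, h]⟩
  · exact ⟨Fin.elim0, rfl⟩
  · exact IsTermsCode.cons
  · exact ⟨.falsum, rfl⟩
  · exact fun ⟨t, ht⟩ ⟨s, hs⟩ => ⟨.equal t s, by rw [gForm, ht, hs]⟩
  · exact fun ⟨τ, h⟩ => ⟨.rel (l := v 1) (v 3) τ, by rw [gForm, h]⟩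
  · exact fun ⟨φ, hφ⟩ ⟨ψ, hψ⟩ => ⟨.imp φ ψ, by rw [gForm, hφ, hψ]⟩
  · exact fun ⟨φ, hφ⟩ => ⟨.all φ, by rw [gForm, hφ]⟩
  · rintro h A rfl
    exact h
  · rintro A rfl
    trivial
  · rintro A rfl
    trivial
  · rintro h₁ h₂ A ⟨B, C, rfl, hB, hC⟩
    exact ⟨h₁ B hB, h₂ C hC⟩
  · rintro t A - rfl
    rfl
  · rintro t A ht rfl
    exact ht
  · rintro t A - rfl
    rfl
  · rintro t A - rfl
    rfl
  · rintro h₁ h₂ t A ht ⟨B, C, rfl, hB, hC⟩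
    exact ⟨_, _, rfl, h₁ t B ht hB, h₂ t C ht hC⟩

section Programs

open Nat.Partrec

theorem gProg_eq_pair {p : Code} {a b : ℕ} :
    gProg p = Nat.pair 4 (Nat.pair a b) ↔ ∃ q r, p = .pair q r ∧ gProg q = a ∧ gProg r = b := by
  cases p <;> simp [gProg]

theorem gProg_eq_comp {p : Code} {a b : ℕ} :
    gProg p = Nat.pair 5 (Nat.pair a b) ↔ ∃ q r, p = .comp q r ∧ gProg q = a ∧ gProg r = b := by
  cases p <;> simp [gProg]

theorem gProg_eq_prec {p : Code} {a b : ℕ} :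
    gProg p = Nat.pair 6 (Nat.pair a b) ↔ ∃ q r, p = .prec q r ∧ gProg q = a ∧ gProg r = b := by
  cases p <;> simp [gProg]

theorem gProg_eq_find {p : Code} {a : ℕ} :
    gProg p = Nat.pair 7 a ↔ ∃ q, p = .rfind' q ∧ gProg q = a := by
  cases p <;> simp [gProg]

theorem gProg_eq_basic {p : Code} {k : ℕ} (hk : k < 4) :
    gProg p = Nat.pair k 0 ↔ p = ![.zero, .succ, .left, .right] ⟨k, hk⟩ := by
  interval_cases k <;> cases p <;> simp [gProg]

theorem mem_eval_find {q : Code} {a n y : ℕ} :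
    y ∈ (Code.rfind' q).eval (Nat.pair a n) ↔ ∃ k, k + n = y ∧ 0 ∈ q.eval (Nat.pair a (k + n)) ∧
      ∀ j < k, ∃ z, z + 1 ∈ q.eval (Nat.pair a (j + n)) := by
  have hfalse (k : ℕ) : false ∈ Part.map (fun m => decide (m = 0)) (q.eval (Nat.pair a (k + n))) ↔
      ∃ z, z + 1 ∈ q.eval (Nat.pair a (k + n)) := by
    rw [Part.mem_map_iff]
    constructor
    · rintro ⟨_ | z, hz, h⟩
      · simp at h
      · exact ⟨z, hz⟩
    · exact fun ⟨z, hz⟩ => ⟨z + 1, hz, by simp⟩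
  have htrue (k : ℕ) : true ∈ Part.map (fun m => decide (m = 0)) (q.eval (Nat.pair a (k + n))) ↔
      0 ∈ q.eval (Nat.pair a (k + n)) := by
    simp [Part.mem_map_iff]
  simp only [Code.eval, Nat.unpaired, Nat.unpair_pair, Part.map_eq_map]
  rw [Part.mem_map_iff]
  constructor
  · rintro ⟨k, h, hk⟩
    have h := Nat.mem_rfind.1 h
    exact ⟨k, hk, (htrue k).1 h.1, fun j hj => (hfalse j).1 (h.2 hj)⟩
  · rintro ⟨k, hk, h₁, h₂⟩
    exact ⟨k, Nat.mem_rfind.2 ⟨(htrue k).2 h₁, fun hj => (hfalse _).2 (h₂ _ hj)⟩, hk⟩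

theorem sound_evalRules : ∀ r ∈ evalRules, r.Sound T := by
  simp only [evalRules, List.forall_mem_cons, Rule.Sound, List.not_mem_nil, false_imp_iff,
    implies_true, and_true, forall_true_left, valid_jEval, and_imp]
  simp only [pZero, pSucc, pLeft, pRight, pPair, pComp, pPrec, pFind, Pat.eval, gProg_eq_pair,
    gProg_eq_comp, gProg_eq_prec, gProg_eq_find]
  refine ⟨?_, ?_, ?_, ?_, ?_, ?_, ?_, ?_, ?_, ?_⟩
  all_goals intro v
  · intro p hp
    obtain rfl := (gProg_eq_basic (by norm_num)).1 hp
    exact Part.mem_some 0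
  · intro p hp
    obtain rfl := (gProg_eq_basic (by norm_num)).1 hp
    simp [Code.eval]
  · intro p hp
    obtain rfl := (gProg_eq_basic (by norm_num)).1 hp
    simp [Code.eval]
  · intro p hp
    obtain rfl := (gProg_eq_basic (by norm_num)).1 hp
    simp [Code.eval]
  · rintro h₁ h₂ _ ⟨q, r, rfl, hq, hr⟩
    simp only [Code.eval, Seq.seq, Part.map_eq_map]
    exact Part.mem_bind (Part.mem_map _ (h₁ q hq)) (Part.mem_map _ (h₂ r hr))
  · rintro h₁ h₂ _ ⟨q, r, rfl, hq, hr⟩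
    exact Part.mem_bind (h₁ r hr) (h₂ q hq)
  · rintro h _ ⟨q, r, rfl, hq, hr⟩
    rw [Code.eval_prec_zero]
    exact h q hq
  · rintro h₁ h₂ _ ⟨q, r, rfl, hq, hr⟩
    rw [Code.eval_prec_succ]
    exact Part.mem_bind (h₁ _ ⟨q, r, rfl, hq, hr⟩) (h₂ r hr)
  · rintro h _ ⟨q, rfl, hq⟩
    exact mem_eval_find.2 ⟨0, Nat.zero_add _, (Nat.zero_add (v 2)).symm ▸ h q hq,
      fun j hj => (Nat.not_lt_zero j hj).elim⟩
  · rintro h₁ h₂ _ ⟨q, rfl, hq⟩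
    obtain ⟨k, hk, h₀, h⟩ := mem_eval_find.1 (h₂ _ ⟨q, rfl, hq⟩)
    refine mem_eval_find.2 ⟨k + 1, by omega, ?_, fun j hj => ?_⟩
    · rwa [show k + 1 + v 2 = k + (v 2 + 1) by omega]
    · rcases j with - | j
      · exact ⟨v 3, (Nat.zero_add (v 2)).symm ▸ h₁ q hq⟩
      · rw [show j + 1 + v 2 = j + (v 2 + 1) by omega]
        exact h j (by omega)

end Programs

theorem gForm_inst {φ : L.BoundedFormula ℕ 1} {t : L.Term (ℕ ⊕ Fin 0)} {c : ℕ}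
    (h : ∀ s A : Tree, s.code = gTerm t → A.code = gForm φ → (A.inst s).code = c) :
    gForm (inst φ t) = c := by
  rw [← Tree.code_ofForm, Tree.ofForm_inst]
  exact h _ _ (Tree.code_ofTerm t) (Tree.code_ofForm φ)

theorem sound_derRules {e : Nat.Partrec.Code} (he : Decides e T) :
    ∀ r ∈ derRules e, r.Sound T := by
  simp only [derRules, List.forall_mem_cons, Rule.Sound, List.not_mem_nil, false_imp_iff,
    implies_true, and_true, valid_jTerm, valid_jForm, valid_jFresh, valid_jInst,
    valid_jEval, valid_jDer, falsum, equal, imp, all, eval_free, eval_atom, eval_node, and_imp]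
  simp only [Pat.eval]
  refine ⟨?_, ?_, ?_, ?_, ?_, ?_, ?_, ?_, ?_⟩
  all_goals intro v
  · intro h
    by_contra hn
    have := (he (v 0)).2 fun ⟨σ, hσ, hm⟩ => hn ⟨embed σ, hm, .ax σ hσ⟩
    exact one_ne_zero (Part.mem_unique (h e rfl) this)
  · rintro ⟨φ, hφ⟩ ⟨ψ, hψ⟩
    exact ⟨_, by simp only [gForm, hφ, hψ], .weak φ ψ⟩
  · rintro ⟨φ, hφ⟩ ⟨ψ, hψ⟩ ⟨χ, hχ⟩
    exact ⟨_, by simp only [gForm, hφ, hψ, hχ], .frege φ ψ χ⟩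
  · rintro ⟨φ, hφ⟩
    exact ⟨_, by simp only [gForm, hφ], .dne φ⟩
  · rintro ⟨φ, hφ⟩ ⟨t, ht⟩ h
    rw [← hφ, ← ht] at h
    exact ⟨_, by simp only [gForm, hφ, gForm_inst h], .spec φ t⟩
  · rintro ⟨t, ht⟩
    exact ⟨_, by simp only [Term.bdEqual, gForm, ht], .refl t⟩
  · rintro ⟨t, ht⟩ ⟨s, hs⟩ ⟨φ, hφ⟩ h₁ h₂
    rw [← hφ, ← ht] at h₁
    rw [← hφ, ← hs] at h₂
    exact ⟨_, by simp only [Term.bdEqual, gForm, ht, hs, gForm_inst h₁, gForm_inst h₂],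
      .leib t s φ⟩
  · rintro ⟨φ, hφ, h⟩ ⟨ψ, hψ, h'⟩
    obtain ⟨χ, θ, rfl, hχ, hθ⟩ := gForm_eq_imp hφ
    obtain rfl := gForm_injective (hχ.trans hψ.symm)
    exact ⟨θ, hθ, .mp χ θ h h'⟩
  · rintro ⟨φ, hφ⟩ h₁ h₂ h₃ ⟨ψ, hψ, h⟩
    obtain ⟨χ, θ, rfl, hχ, hθ⟩ := gForm_eq_imp hψ
    have hi : gForm (inst φ (fvar (v 3))) = v 2 := gForm_inst (hφ.symm ▸ h₃)
    obtain rfl := gForm_injective (hθ.trans hi.symm)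
    refine ⟨χ ⟹ ∀' φ, by simp only [gForm, hχ, hφ], .gen χ φ (v 3) ?_ ?_ h⟩
    · exact Tree.notMem_of_fresh_ofForm (h₁ _ ((Tree.code_ofForm χ).trans hχ))
    · exact Tree.notMem_of_fresh_ofForm (h₂ _ ((Tree.code_ofForm φ).trans hφ))

theorem sound_rules {e : Nat.Partrec.Code} (he : Decides e T) : ∀ r ∈ rules e, r.Sound T := by
  simp only [rules, List.mem_append]
  rintro r ((h | h) | h)
  · exact sound_sideRules r h
  · exact sound_evalRules r h
  · exact sound_derRules he r h

end Valid

/-- The formula of which there is a coded derivation is derivable. -/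
theorem IsProof.derivable {T : L.Theory} {e : Nat.Partrec.Code} (he : Decides e T) {p : ℕ}
    {φ : L.BoundedFormula ℕ 0} (h : IsProof e p (gForm φ)) : Derivable T φ := by
  obtain ⟨⟨i, hi, hx⟩, H⟩ := h
  have valid (j : ℕ) : j < p.unpair.1 → Valid T (Nat.beta p.unpair.2 j) := by
    induction j using Nat.strong_induction_on with
    | _ j ih =>
      intro hj
      obtain ⟨r, hr, v, h₁, h₂⟩ := H j hj
      refine h₁ ▸ sound_rules he r hr v fun q hq => ?_
      obtain ⟨k, hk, h⟩ := h₂ q hq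
      exact h ▸ ih k hk (hk.trans hj)
  have hv : Valid T ((Pat.jDer (Pat.lit (gForm φ))).eval fun _ => 0) :=
    show Valid T (Nat.pair 7 (gForm φ)) from hx ▸ valid i (by omega)
  obtain ⟨ψ, hψ, h⟩ := valid_jDer.1 hv
  exact gForm_injective hψ ▸ h

/-! ### The consistency instances -/

/-- Elementary arithmetic decides the instances of the proof predicate. -/
theorem EA.decides_proofS (e : Nat.Partrec.Code) (p x : ℕ) :
    (IsProof e p x → Proves EA (proofS e p x)) ∧ (¬ IsProof e p x → Proves EA ∼(proofS e p x)) := by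
  have h := EA.decides_delta0 (IsDelta0.proofF e) ![p, x]
  have hv : (fun i => num (![p, x] i)) =
      fun i => tembed ((![num p, num x] : Fin 2 → L.Term (Empty ⊕ Fin 0)) i) := by
    funext i
    fin_cases i <;> simp
  rw [realize_proofF, hv, ← bembed_bsub] at h
  exact h

theorem computablePred_isProof (e : Nat.Partrec.Code) (x : ℕ) :
    ComputablePred fun p => IsProof e p x := by
  refine PrimrecPred.computablePred (((IsDelta0.proofF e).primrecPred
    (f := fun p => ![p, x]) fun i => ?_).of_eq fun p => realize_proofF e p x)
  fin_cases i
  · exact Primrec.id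
  · exact Primrec.const x

end ConsistencySchema

theorem mainTheorem4 (T : ConsistencySchema.L.Theory) (e : Nat.Partrec.Code) (he : ConsistencySchema.Decides e T) :
    ComputablePred (fun n : ℕ => ConsistencySchema.IsProof e n (ConsistencySchema.gSent ConsistencySchema.zeroEqOne)) ∧
    (∀ n : ℕ,
      (ConsistencySchema.IsProof e n (ConsistencySchema.gSent ConsistencySchema.zeroEqOne) → ConsistencySchema.Proves ConsistencySchema.EA (ConsistencySchema.proofS e n (ConsistencySchema.gSent ConsistencySchema.zeroEqOne))) ∧
      (¬ ConsistencySchema.IsProof e n (ConsistencySchema.gSent ConsistencySchema.zeroEqOne) → ConsistencySchema.Proves ConsistencySchema.EA ∼(ConsistencySchema.proofS e n (ConsistencySchema.gSent ConsistencySchema.zeroEqOne)))) ∧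
    (ConsistencySchema.Consistent T → ConsistencySchema.Extends T ConsistencySchema.EA → ∀ n : ℕ, ConsistencySchema.Proves T (ConsistencySchema.conInst e n)) := by
  open ConsistencySchema in
  refine ⟨computablePred_isProof e _, fun n => EA.decides_proofS e n _, fun hc hT n => ?_⟩
  refine Derivable.of_extends hT ((EA.decides_proofS e n _).2 fun h => hc ?_)
  have h₁ : Derivable EA ∼(bembed zeroEqOne) := by
    simpa [zeroEqOne] using show Derivable EA ∼(num 0 =' num 1) from
      EA.num_ne (Γ := []) zero_ne_one
  exact .mp _ _ (h₁.of_extends hT) (IsProof.derivable he h)
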